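/- Let $d,i,q$ be integers with $0<i<d-1$ and $q\ge 1$, let $\beta\in[0,\infty)$ and $p=1-e^{-\beta}$. View $\mathbb Z^d$ as the cubical complex whose $k$-cells are the $k$-dimensional unit cubes with integer corners, write $\Lambda_N=[-N,N]^d$, and let $\mathcal P_N$ be the set of $i$-cells of $\Lambda_N$ that are not contained in $\partial\Lambda_N$. Chains are finite, coefficients are in $\mathbb Z_q=\mathbb Z/q\mathbb Z$, and homology, cohomology and cycles are reduced (so a $0$-cycle is a $0$-chain with coefficient sum $0$). *Potts lattice gauge theory.* Let $\nu^{\mathbf f}_N$ be the probability measure on $C^{i-1}(\Lambda_N;\mathbb Z_q)$ with $\nu^{\mathbf f}_N(f)\propto e^{-\beta H(f)}$, $H(f)=-\#\{\sigma\in\mathcal P_N:\delta f(\sigma)=0\}$, and let $\nu^{\mathbf w}_N$ be $\nu^{\mathbf f}_N$ conditioned on the restriction of $f$ to $\partial\Lambda_N$ being a cocycle. *Plaquette random-cluster model.* For $P\subseteq\mathcal P_N$ let $P^{\mathbf f}$ be the complex formed by all cells of $\Lambda_N$ of dimension at most $i-1$ and the plaquettes of $P$, and let $P^{\mathbf w}$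 be $P^{\mathbf f}$ together with all $i$-cells in $\partial\Lambda_N$. For $\#\in\{\mathbf f,\mathbf w\}$ let $\tilde\mu^{\#}_N$ be the probability measure on subsets of $\mathcal P_N$ with $$\tilde\mu^{\#}_N(P)\propto p^{|P|}(1-p)^{|\mathcal P_N|-|P|}\,\bigl|H^{i-1}(P^{\#};\mathbb Z_q)\bigr|.$$ *Wilson loop variables and events.* For an $(i-1)$-cycle $\gamma$ of $\mathbb Z^d$ with coefficients in $\mathbb Z_q$ and an $(i-1)$-cochain $f$ let $W_\gamma(f)=e^{2\pi \sqrt{-1}\,f(\gamma)/q}$. For a set $P$ of $i$-cells of $\mathbb Z^d$ let $V^{\mathrm{fin}}_\gamma$ be the event that $\gamma=\partial\tau$ for some finite $i$-chain $\tau$ of plaquettes of $P$, and let $V^{\mathrm{inf}}_\gamma$ be the union of $V^{\mathrm{fin}}_\gamma$ and the event that, for arbitrarily large $n$, there are an $(i-1)$-cycle $c$ in $\partial\Lambda_n$ and a finite $i$-chain $\tau$ of plaquettes of $P$ with $\partial\tau=\gamma-c$. **Theorem.** For $(\#_1,\#_2)\in\{(\mathbf f,\mathrm{fin}),(\mathbf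 w,\mathrm{inf})\}$ the weak limits $$\nu=\lim_{N\to\infty}\nu^{\#_1}_N,\qquad \tilde\mu=\lim_{N\to\infty}\tilde\mu^{\#_1}_N$$ exist as probability measures on $(i-1)$-cochains and on sets of $i$-cells of $\mathbb Z^d$ (with the product topologies), and for every $(i-1)$-cycle $\gamma$ of $\mathbb Z^d$ with coefficients in $\mathbb Z_q$ $$\mathbb E_\nu(W_\gamma)=\tilde\mu\bigl(V^{\#_2}_\gamma\bigr).$$ -/

import Mathlib

open MeasureTheory Filter Topology
open scoped ENNReal

noncomputable section

namespace PlaquetteModel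

/-! ### The cubical complex `ℤ^d`: cells, chains, cochains -/

/-- A `k`-cell (`k`-plaquette) of `ℤ^d`, given by its lowest corner `x` and the set `S` of the `k`
directions in which it extends: it is the cube `∏ j, I j` with `I j = [x j, x j + 1]` for `j ∈ S`
and `I j = {x j}` for `j ∉ S`. -/
abbrev Cell (d k : ℕ) : Type := (Fin d → ℤ) × {S : Finset (Fin d) // S.card = k}

namespace Cell

variable {d k : ℕ}

/-- The face of a cell at the lower end of the direction `j`. -/
def lowerFace (σ : Cell d (k + 1)) (j : {j // j ∈ σ.2.1}) : Cell d k :=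
  (σ.1, ⟨σ.2.1.erase j, by rw [Finset.card_erase_of_mem j.2, σ.2.2]; rfl⟩)

/-- The face of a cell at the upper end of the direction `j`. -/
def upperFace (σ : Cell d (k + 1)) (j : {j // j ∈ σ.2.1}) : Cell d k :=
  (σ.1 + Pi.single j.1 1, ⟨σ.2.1.erase j, by rw [Finset.card_erase_of_mem j.2, σ.2.2]; rfl⟩)

/-- The closed cell is contained in the cube `Λ_N = [-N, N]^d`. -/
def InBox (N : ℕ) (σ : Cell d k) : Prop :=
  ∀ j, -(N : ℤ) ≤ σ.1 j ∧ σ.1 j + (if j ∈ σ.2.1 then 1 else 0) ≤ (N : ℤ)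

/-- The closed cell is contained in the topological boundary of the cube `Λ_N = [-N, N]^d`. -/
def InBdry (N : ℕ) (σ : Cell d k) : Prop :=
  σ.InBox N ∧ ∃ j, j ∉ σ.2.1 ∧ (σ.1 j = -(N : ℤ) ∨ σ.1 j = (N : ℤ))

end Cell

/-- `k`-chains of `ℤ^d` with coefficients in `ℤ/q`: finite formal combinations of `k`-cells. -/
abbrev Chain (d k q : ℕ) : Type := Cell d k →₀ ZMod q

/-- `k`-cochains of `ℤ^d` with coefficients in `ℤ/q`. -/
abbrev Cochain (d k q : ℕ) : Type := Cell d k → ZMod q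

variable {d k q : ℕ}

/-- The boundary of a cell: if `j_1 < ⋯ < j_k` are the directions of `σ`, it is the sum over `l` of
`(-1)^(l-1)` times (upper face minus lower face in the direction `j_l`). -/
def cellBoundary (q : ℕ) (σ : Cell d (k + 1)) : Chain d k q :=
  ∑ j : {j // j ∈ σ.2.1}, (-1 : ZMod q) ^ (σ.2.1.filter (fun m => m < j.1)).card •
    (Finsupp.single (σ.upperFace j) 1 - Finsupp.single (σ.lowerFace j) 1)

/-- The boundary operator on chains. -/
def boundary : Chain d (k + 1) q →ₗ[ZMod q] Chain d k q :=
  Finsupp.linearCombination (ZMod q) (cellBoundary q)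

/-- The cycles of the reduced (augmented) chain complex: in degree `0` these are the `0`-chains with
coefficient sum `0`, in positive degree the chains with zero boundary. -/
def IsCycle : {k : ℕ} → Chain d k q → Prop
  | 0, γ => (γ.sum fun _ a => a) = 0
  | _ + 1, γ => boundary γ = 0

/-- The value `f(γ)` of a cochain on a chain. -/
def evalChain (f : Cochain d k q) (γ : Chain d k q) : ZMod q :=
  γ.sum fun σ a => a * f σ

/-- The coboundary operator, `(δ f)(σ) = f(∂ σ)`. -/
def coboundary : Cochain d k q →ₗ[ZMod q] Cochain d (k + 1) q where
  toFun f σ := evalChain f (cellBoundary q σ)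
  map_add' f g := by
    funext σ
    simp [evalChain, Finsupp.sum, mul_add, Finset.sum_add_distrib]
  map_smul' a f := by
    funext σ
    simp [evalChain, Finsupp.sum, Finset.mul_sum, mul_left_comm]

/-! ### Cochains and cohomology in the cube `Λ_N = [-N, N]^d` -/

/-- The `k`-cells of `Λ_N`. -/
abbrev BoxCell (d k N : ℕ) : Type := {σ : Cell d k // σ.InBox N}

/-- The `k`-cells of `Λ_N` that are not contained in the boundary of `Λ_N`. -/
abbrev IntCell (d k N : ℕ) : Type := {σ : Cell d k // σ.InBox N ∧ ¬ σ.InBdry N}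

instance (N : ℕ) : Finite (BoxCell d k N) := by
  have h : (Set.Icc (fun _ : Fin d => -(N : ℤ)) (fun _ => (N : ℤ))).Finite := Set.finite_Icc _ _
  have := h.to_subtype
  refine Finite.of_injective
    (β := (Set.Icc (fun _ : Fin d => -(N : ℤ)) (fun _ => (N : ℤ))) ×
      {S : Finset (Fin d) // S.card = k})
    (fun σ => (⟨σ.1.1, ?_⟩, σ.1.2)) ?_
  · refine ⟨fun j => (σ.2 j).1, fun j => ?_⟩
    have := (σ.2 j).2
    split_ifs at this <;> simp only <;> omega
  · intro σ τ hst
    simp only [Prod.mk.injEq] at hst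
    exact Subtype.ext (Prod.ext (congrArg Subtype.val hst.1) hst.2)

instance (N : ℕ) : Finite (IntCell d k N) :=
  Finite.of_injective (β := BoxCell d k N) (fun σ => ⟨σ.1, σ.2.1⟩) fun σ τ h => by
    simpa [Subtype.ext_iff] using h

instance (N : ℕ) : Fintype (BoxCell d k N) := Fintype.ofFinite _

instance (N : ℕ) : Fintype (IntCell d k N) := Fintype.ofFinite _

/-- `k`-cochains of `Λ_N` with coefficients in `ℤ/q`. -/
abbrev BoxCochain (d k q N : ℕ) : Type := BoxCell d k N → ZMod q

/-- Extension of a cochain of `Λ_N` to `ℤ^d` by zero. -/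
def extendZero (N : ℕ) : BoxCochain d k q N →ₗ[ZMod q] Cochain d k q :=
  Function.ExtendByZero.linearMap (ZMod q) Subtype.val

/-- The coboundary operator of `Λ_N`. (All faces of a cell of `Λ_N` lie in `Λ_N`, so that the values
outside `Λ_N` of the extension play no role.) -/
def boxCoboundary (N : ℕ) : BoxCochain d k q N →ₗ[ZMod q] BoxCochain d (k + 1) q N :=
  LinearMap.funLeft (ZMod q) (ZMod q) Subtype.val ∘ₗ coboundary ∘ₗ extendZero N

/-- The cocycle group `Z^k(P; ℤ/q)` of the subcomplex `P` of `Λ_N` that consists of all cells of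
`Λ_N` of dimension at most `k` and of the `(k+1)`-cells in `A`. -/
def cocycles (q N : ℕ) (A : Set (BoxCell d (k + 1) N)) :
    Submodule (ZMod q) (BoxCochain d k q N) where
  carrier := {f | ∀ σ ∈ A, boxCoboundary N f σ = 0}
  add_mem' hf hg σ hσ := by simp [hf σ hσ, hg σ hσ]
  zero_mem' σ _ := by simp
  smul_mem' a f hf σ hσ := by simp [hf σ hσ]

/-- The coboundary group `B^k` of `Λ_N` in the reduced (augmented) cochain complex: in degree `0`
these are the constant cochains. The same group serves for each subcomplex of `Λ_N` that contains
all cells of dimension at most `k`. -/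
def coboundaries (q N : ℕ) : (k : ℕ) → Submodule (ZMod q) (BoxCochain d k q N)
  | 0 => Submodule.span (ZMod q) {fun _ => 1}
  | _ + 1 => LinearMap.range (boxCoboundary N)

/-- The reduced cohomology group `H^k(P; ℤ/q) = Z^k / B^k` of the subcomplex `P` of `Λ_N` that
consists of all cells of `Λ_N` of dimension at most `k` and of the `(k+1)`-cells in `A`. -/
abbrev Cohomology (q N : ℕ) (A : Set (BoxCell d (k + 1) N)) : Type :=
  cocycles q N A ⧸ (coboundaries q N k).submoduleOf (cocycles q N A)

/-! ### Finite volume measures -/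

/-- Free and wired boundary conditions. -/
inductive BC
  | free
  | wired

/-- The Hamiltonian `H(f) = - ∑_σ K(δ f(σ), 0)` of `k`-dimensional Potts lattice gauge theory on
`Λ_N`; the sum is over the `(k+1)`-plaquettes of `Λ_N` that are not in the boundary. -/
def hamiltonian (N : ℕ) (f : BoxCochain d k q N) : ℝ :=
  -∑ σ : IntCell d (k + 1) N, if boxCoboundary N f ⟨σ.1, σ.2.1⟩ = 0 then (1 : ℝ) else 0

/-- The cochains of `Λ_N` admitted by the boundary condition: all of them for free boundary
conditions, those which restrict to a cocycle on the boundary of `Λ_N` for wired ones. -/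
def admissible (N : ℕ) : BC → Set (BoxCochain d k q N)
  | .free => Set.univ
  | .wired => {f | ∀ σ : BoxCell d (k + 1) N, σ.1.InBdry N → boxCoboundary N f σ = 0}

open Classical in
/-- The unnormalized weight of a cochain in Potts lattice gauge theory on `Λ_N`. -/
def plgtWeight (N : ℕ) (b : BC) (β : ℝ) (f : BoxCochain d k q N) : ℝ≥0∞ :=
  if f ∈ admissible N b then ENNReal.ofReal (Real.exp (-β * hamiltonian N f)) else 0

lemma plgtWeight_tsum_ne_zero (N : ℕ) (b : BC) (β : ℝ) :
    ∑' f : BoxCochain d k q N, plgtWeight N b β f ≠ 0 := by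
  intro h
  have h0 := ENNReal.tsum_eq_zero.1 h 0
  have hm : (0 : BoxCochain d k q N) ∈ admissible N b := by
    cases b <;> simp [admissible]
  rw [plgtWeight, if_pos hm, ENNReal.ofReal_eq_zero] at h0
  exact absurd h0 (not_le.2 (Real.exp_pos _))

lemma plgtWeight_tsum_ne_top [NeZero q] (N : ℕ) (b : BC) (β : ℝ) :
    ∑' f : BoxCochain d k q N, plgtWeight N b β f ≠ ∞ := by
  rw [tsum_fintype]
  refine ENNReal.sum_ne_top.2 fun f _ => ?_
  unfold plgtWeight
  split_ifs <;> simp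

/-- `k`-dimensional `q`-state Potts lattice gauge theory on `Λ_N` at inverse temperature `β` with the
given boundary condition, as a law on the cochains of `Λ_N`. -/
def plgtBox [NeZero q] (N : ℕ) (b : BC) (β : ℝ) : PMF (BoxCochain d k q N) :=
  PMF.normalize (plgtWeight N b β) (plgtWeight_tsum_ne_zero N b β) (plgtWeight_tsum_ne_top N b β)

/-- The same law, seen as a law on the cochains of `ℤ^d` (extended by zero outside `Λ_N`; weak limits
as `N → ∞` do not depend on the choice of the extension). -/
def plgt (d k q : ℕ) [NeZero q] (b : BC) (β : ℝ) (N : ℕ) : ProbabilityMeasure (Cochain d k q) :=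
  ⟨((plgtBox N b β).map (extendZero N)).toMeasure, inferInstance⟩

/-- The plaquettes of the complex whose cohomology enters the weight of `P`: those of `P` for free
boundary conditions; for wired boundary conditions all those in the boundary of `Λ_N` are added. -/
def withBoundary (N : ℕ) (P : Finset (IntCell d k N)) : BC → Set (BoxCell d k N)
  | .free => {σ | ∃ τ ∈ P, τ.1 = σ.1}
  | .wired => {σ | (∃ τ ∈ P, τ.1 = σ.1) ∨ σ.1.InBdry N}

/-- The unnormalized weight `p^|P| (1-p)^(|X|-|P|) |H^k(P; ℤ/q)|` of a set `P` of plaquettes of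
dimension `k + 1` in the plaquette random-cluster model on `Λ_N`, where `X` is the set of
`(k+1)`-plaquettes of `Λ_N` that are not in the boundary. -/
def prcmWeight (q N : ℕ) (b : BC) (p : unitInterval) (P : Finset (IntCell d (k + 1) N)) : ℝ≥0∞ :=
  ENNReal.ofReal ((p : ℝ) ^ P.card * (1 - (p : ℝ)) ^ (Fintype.card (IntCell d (k + 1) N) - P.card)
    * Nat.card (Cohomology q N (withBoundary N P b)))

lemma prcmWeight_tsum_ne_zero [NeZero q] (N : ℕ) (b : BC) (p : unitInterval) :
    ∑' P : Finset (IntCell d (k + 1) N), prcmWeight q N b p P ≠ 0 := by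
  intro h
  have hcard : ∀ A : Set (BoxCell d (k + 1) N), (0 : ℝ) < Nat.card (Cohomology q N A) := by
    intro A
    have : Finite (Cohomology q N A) := Finite.of_surjective _ (Submodule.mkQ_surjective _)
    exact_mod_cast Nat.card_pos
  have h0 := fun P => ENNReal.ofReal_eq_zero.1 (ENNReal.tsum_eq_zero.1 h P)
  rcases eq_or_lt_of_le p.2.2 with hp | hp
  · have := h0 Finset.univ
    simp only [Finset.card_univ, Nat.sub_self, pow_zero, mul_one, hp, one_pow, one_mul] at this
    exact absurd this (not_le.2 (hcard _))
  · have := h0 ∅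
    simp only [Finset.card_empty, pow_zero, one_mul, Nat.sub_zero] at this
    exact absurd this (not_le.2 (mul_pos (pow_pos (by linarith) _) (hcard _)))

lemma prcmWeight_tsum_ne_top (N : ℕ) (b : BC) (p : unitInterval) :
    ∑' P : Finset (IntCell d (k + 1) N), prcmWeight q N b p P ≠ ∞ := by
  rw [tsum_fintype]
  exact ENNReal.sum_ne_top.2 fun P _ => ENNReal.ofReal_ne_top

/-- The `(k+1)`-dimensional plaquette random-cluster model on `Λ_N` with coefficients in `ℤ/q`, as a
law on sets of plaquettes. -/
def prcmBox (q : ℕ) [NeZero q] (N : ℕ) (b : BC) (p : unitInterval) :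
    PMF (Finset (IntCell d (k + 1) N)) :=
  PMF.normalize (prcmWeight q N b p) (prcmWeight_tsum_ne_zero N b p)
    (prcmWeight_tsum_ne_top N b p)

/-- Plaquette configurations on `ℤ^d`: the percolation subcomplex contains all cells of dimension
smaller than `k`, and those `k`-cells at which the configuration takes the value `true`. -/
abbrev Config (d k : ℕ) : Type := Cell d k → Bool

open Classical in
/-- The configuration on `ℤ^d` of a set of plaquettes of `Λ_N`. -/
def toConfig (N : ℕ) (P : Finset (IntCell d k N)) : Config d k :=
  fun σ => decide (∃ τ ∈ P, τ.1 = σ)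

/-- The plaquette random-cluster model on `Λ_N`, as a law on the plaquette configurations on `ℤ^d`
(no plaquettes are placed outside `Λ_N`; weak limits as `N → ∞` do not depend on this choice). -/
def prcm (d k q : ℕ) [NeZero q] (b : BC) (p : unitInterval) (N : ℕ) :
    ProbabilityMeasure (Config d (k + 1)) :=
  ⟨((prcmBox q N b p).map (toConfig N)).toMeasure, inferInstance⟩

/-! ### Wilson loop variables and the events `V_γ` -/

/-- The Wilson loop variable `W_γ(f)`: the value `f(γ)`, seen as a complex `q`-th root of unity
through `j ↦ exp(2 π i j / q)`. -/
def wilson [NeZero q] (γ : Chain d k q) (f : Cochain d k q) : ℂ :=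
  ZMod.stdAddChar (evalChain f γ)

/-- A chain consists of plaquettes of the configuration `ω`. -/
def SupportedIn (ω : Config d k) (τ : Chain d k q) : Prop :=
  ∀ σ ∈ τ.support, ω σ = true

/-- The event that `γ` is a boundary in `P`. -/
def VFin (γ : Chain d k q) : Set (Config d (k + 1)) :=
  {ω | ∃ τ : Chain d (k + 1) q, SupportedIn ω τ ∧ boundary τ = γ}

/-- The event that for arbitrarily large `n` the chain `γ` is homologous in `P` to a cycle in the
boundary of the cube `[-n, n]^d`. -/
def HomologousToInfinity (γ : Chain d k q) : Set (Config d (k + 1)) :=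
  {ω | ∀ m : ℕ, ∃ n ≥ m, ∃ c : Chain d k q, IsCycle c ∧ (∀ σ ∈ c.support, σ.InBdry n) ∧
    ∃ τ : Chain d (k + 1) q, SupportedIn ω τ ∧ boundary τ = γ - c}

/-- The event that belongs to a boundary condition: `γ` bounds for free boundary conditions, `γ`
bounds or is homologous to infinity for wired ones. -/
def V (γ : Chain d k q) : BC → Set (Config d (k + 1))
  | .free => VFin γ
  | .wired => VFin γ ∪ HomologousToInfinity γ

end PlaquetteModel

end

/-! Finite volume. Writing each Gibbs factor as `exp β * (p * 1 + (1 - p))` or `exp β * (1 - p)` and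
expanding the product (`gibbsWeight_eq`) couples the two models: given a plaquette set, the cochain
is uniform on the finite group of cocycles of the corresponding complex. On this group `W_γ` is a
character, so its mean is 1 if all cocycles vanish on `γ` and 0 otherwise
(`sum_wilson_localCocycles`). This gives `integral_wilson_eq_prob`, with the event `localV b N γ`.
By duality over `ℤ/q` (`annihilated_iff`) that event says that `γ` bounds in the open plaquettes of
the cube, with the boundary plaquettes added in the wired case.

Monotonicity. The number of cocycles is log-supermodular, because the cocycles of `P ∪ Q` are the
intersection of those of `P` and of `Q`, and both groups lie in the cocycles of `P ∩ Q`. The model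
on a small cube corresponds to the model on a larger cube with all outer plaquettes closed (free) or
open (wired): pulling back along the retraction onto the small cube extends cocycles outwards, so
the cocycle counts are proportional (`exists_card_localCocycles_enlarge`). Holley's inequality then
makes probabilities of increasing local events nondecreasing in the volume for free and
nonincreasing for wired boundary conditions. The events `localV` move with the volume in the same
sense, so all probabilities needed converge. Stone–Weierstrass and compactness turn this into weak
convergence of both models (`exists_tendsto_of_separating`).

Limit. `V γ b` is the increasing union (free) or decreasing intersection (wired) of the local
events, and monotonicity allows the event and the volume to tend to infinity together
(`tendsto_prob_localV`). The wired identity `V_wired_eq_iInter` needs that cochains which are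
cocycles on the boundary of a cube vanish on its cycles, that is, vanishing of the cohomology of a
sphere below its top degree; this is where `k + 1 < d` enters. It is proved by explicit homotopies,
one coordinate direction at a time. -/

noncomputable section

namespace PlaquetteModel

section TotalCochains

/-! ### Total cochains and their coboundary -/

/-- Cochains of all degrees at once: functions of a lowest corner and a set of directions. -/
abbrev TotalCochain (d q : ℕ) : Type := (Fin d → ℤ) → Finset (Fin d) → ZMod q

variable {d q : ℕ}

/-- The incidence sign of the direction `j` relative to the set of directions `S`. -/
def sgn (q : ℕ) (S : Finset (Fin d)) (j : Fin d) : ZMod q :=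
  (-1) ^ (S.filter (fun m => m < j)).card

lemma sgn_mul_self (S : Finset (Fin d)) (j : Fin d) : sgn q S j * sgn q S j = 1 := by
  rw [sgn, ← mul_pow]; simp

lemma sgn_insert {S : Finset (Fin d)} {i : Fin d} (hi : i ∉ S) (j : Fin d) :
    sgn q (insert i S) j = if i < j then -sgn q S j else sgn q S j := by
  unfold sgn
  rw [Finset.filter_insert]
  split_ifs with h
  · rw [Finset.card_insert_of_notMem (by simp [hi]), pow_succ]; ring
  · rfl

lemma sgn_erase {S : Finset (Fin d)} {i : Fin d} (hi : i ∈ S) (j : Fin d) :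
    sgn q (S.erase i) j = if i < j then -sgn q S j else sgn q S j := by
  have h := sgn_insert (q := q) (Finset.notMem_erase i S) j
  rw [Finset.insert_erase hi] at h
  rw [h]
  split_ifs <;> simp

lemma sgn_erase_self (S : Finset (Fin d)) (j : Fin d) : sgn q (S.erase j) j = sgn q S j := by
  by_cases h : j ∈ S
  · simp [sgn_erase h]
  · rw [Finset.erase_eq_of_notMem h]

lemma sgn_insert_self (S : Finset (Fin d)) (j : Fin d) : sgn q (insert j S) j = sgn q S j := by
  by_cases h : j ∈ S
  · rw [Finset.insert_eq_of_mem h]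
  · simp [sgn_insert h]

/-- The part of the coboundary that differentiates in the direction `j`. -/
def dirCoboundary (j : Fin d) : TotalCochain d q →ₗ[ZMod q] TotalCochain d q where
  toFun F x S := if j ∈ S then
    sgn q S j * (F (x + Pi.single j 1) (S.erase j) - F x (S.erase j)) else 0
  map_add' F G := by
    funext x S
    by_cases h : j ∈ S <;> simp [h]; ring
  map_smul' a F := by
    funext x S
    by_cases h : j ∈ S <;> simp [h]; ring

lemma dirCoboundary_apply (j : Fin d) (F : TotalCochain d q) (x : Fin d → ℤ)
    (S : Finset (Fin d)) : dirCoboundary j F x S = if j ∈ S then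
    sgn q S j * (F (x + Pi.single j 1) (S.erase j) - F x (S.erase j)) else 0 := rfl

/-- The coboundary of total cochains. -/
def totalCoboundary : TotalCochain d q →ₗ[ZMod q] TotalCochain d q := ∑ j, dirCoboundary j

lemma totalCoboundary_apply (F : TotalCochain d q) (x : Fin d → ℤ) (S : Finset (Fin d)) :
    totalCoboundary F x S = ∑ j, dirCoboundary j F x S := by
  simp [totalCoboundary, LinearMap.sum_apply, Finset.sum_apply]

lemma dirCoboundary_self (j : Fin d) (F : TotalCochain d q) :
    dirCoboundary j (dirCoboundary j F) = 0 := by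
  funext x S
  simp [dirCoboundary_apply]

/-- Removing the smaller of the two directions flips the sign of the larger one, while removing the
larger leaves the other sign alone; so the two orders of differentiation differ by exactly one sign.
-/
lemma dirCoboundary_anticomm {i j : Fin d} (hij : i ≠ j) (F : TotalCochain d q) :
    dirCoboundary i (dirCoboundary j F) = -dirCoboundary j (dirCoboundary i F) := by
  funext x S
  simp only [Pi.neg_apply, dirCoboundary_apply, Finset.mem_erase]
  by_cases hi : i ∈ S <;> by_cases hj : j ∈ S <;> simp only [hi, hj, hij, hij.symm, ne_eq,
    not_false_eq_true, and_true, and_false, if_true, if_false, sub_self, mul_zero, neg_zero]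
  rw [sgn_erase hi, sgn_erase hj, Finset.erase_right_comm (a := j) (b := i),
    add_right_comm x (Pi.single j 1)]
  rcases lt_or_gt_of_ne hij with h | h
  · simp only [h, h.not_gt, if_true, if_false]; ring
  · simp only [h, h.not_gt, if_true, if_false]; ring

lemma totalCoboundary_totalCoboundary (F : TotalCochain d q) :
    totalCoboundary (totalCoboundary F) = 0 := by
  simp only [totalCoboundary, LinearMap.sum_apply, map_sum]
  rw [← Finset.sum_product' (s := Finset.univ) (t := Finset.univ)
    (f := fun i j => dirCoboundary j (dirCoboundary i F))]
  refine Finset.sum_involution (fun p _ => (p.2, p.1)) ?_ ?_ ?_ ?_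
  · rintro ⟨i, j⟩ -
    by_cases h : i = j
    · subst h; simp [dirCoboundary_self]
    · simp [dirCoboundary_anticomm h]
  · rintro ⟨i, j⟩ - h0 h
    simp only [Prod.mk.injEq] at h
    obtain ⟨rfl, -⟩ := h
    exact h0 (dirCoboundary_self _ _)
  · simp
  · simp

/-! ### Homotopies in one direction -/

/-- The operator on total cochains that contracts the direction `j` by means of an operator `I` on
functions of one integer variable. -/
def contraction (I : (ℤ → ZMod q) →ₗ[ZMod q] (ℤ → ZMod q)) (j : Fin d) :
    TotalCochain d q →ₗ[ZMod q] TotalCochain d q where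
  toFun F x S := if j ∈ S then 0 else
    sgn q S j * I (fun t => F (Function.update x j t) (insert j S)) (x j)
  map_add' F G := by
    funext x S
    have : (fun t => (F + G) (Function.update x j t) (insert j S)) =
      (fun t => F (Function.update x j t) (insert j S)) +
      fun t => G (Function.update x j t) (insert j S) := rfl
    by_cases h : j ∈ S
    · simp [h]
    · rw [if_neg h, this, map_add]
      simp [h, mul_add]
  map_smul' a F := by
    funext x S
    have : (fun t => (a • F) (Function.update x j t) (insert j S)) =
      a • (fun t => F (Function.update x j t) (insert j S)) := rfl
    by_cases h : j ∈ S
    · simp [h]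
    · rw [if_neg h, this, map_smul]
      simp only [Pi.smul_apply, RingHom.id_apply, smul_eq_mul, h, if_false]
      ring

lemma contraction_apply (I : (ℤ → ZMod q) →ₗ[ZMod q] (ℤ → ZMod q)) (j : Fin d)
    (F : TotalCochain d q) (x : Fin d → ℤ) (S : Finset (Fin d)) :
    contraction I j F x S = if j ∈ S then 0 else
      sgn q S j * I (fun t => F (Function.update x j t) (insert j S)) (x j) := rfl

/-- Operators acting on different coordinates commute; the incidence signs turn this into
anticommutation, as for a tensor product of complexes. -/
lemma dirCoboundary_contraction_of_ne (I : (ℤ → ZMod q) →ₗ[ZMod q] (ℤ → ZMod q)) {i j : Fin d}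
    (hij : i ≠ j) (F : TotalCochain d q) :
    dirCoboundary i (contraction I j F) + contraction I j (dirCoboundary i F) = 0 := by
  funext x S
  simp only [Pi.add_apply, Pi.zero_apply, contraction_apply, dirCoboundary_apply]
  have hI0 : I (fun _ => 0) = 0 := map_zero I
  by_cases hj : j ∈ S
  · simp [hj, hij.symm]
  by_cases hi : i ∈ S
  · have e1 : insert j (S.erase i) = (insert j S).erase i := by
      rw [Finset.erase_insert_of_ne hij.symm]
    have e2 : ∀ t, Function.update (x + Pi.single i 1) j t
        = Function.update x j t + Pi.single i 1 := by
      intro t; funext l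
      by_cases hl : l = j
      · subst hl; simp [hij.symm]
      · simp [hl]
    have e3 : x j + (Pi.single i 1 : Fin d → ℤ) j = x j := by simp [hij.symm]
    have e4 : ∀ (a : ZMod q) (A B : ℤ → ZMod q), I (fun t => a * (A t - B t)) =
        a • (I A - I B) := by
      intro a A B
      rw [← map_sub, ← map_smul]; rfl
    simp only [hi, hj, Finset.mem_erase, Finset.mem_insert, if_true, if_false, and_false, or_true,
      e1, e2, e4, e3, Pi.smul_apply, Pi.sub_apply, smul_eq_mul]
    rw [sgn_erase hi, sgn_insert hj]
    rcases lt_or_gt_of_ne hij with h | h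
    · simp only [h, h.not_gt, if_true, if_false]; ring
    · simp only [h, h.not_gt, if_true, if_false]; ring
  · simp [hi, hj, hij, hI0]

lemma dirCoboundary_contraction_self (I : (ℤ → ZMod q) →ₗ[ZMod q] (ℤ → ZMod q)) (j : Fin d)
    (F : TotalCochain d q) (x : Fin d → ℤ) (S : Finset (Fin d)) :
    dirCoboundary j (contraction I j F) x S + contraction I j (dirCoboundary j F) x S =
      if j ∈ S then I (fun t => F (Function.update x j t) S) (x j + 1) -
        I (fun t => F (Function.update x j t) S) (x j)
      else I (fun t => F (Function.update x j (t + 1)) S - F (Function.update x j t) S) (x j) := by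
  simp only [contraction_apply, dirCoboundary_apply]
  have e2 : ∀ t, Function.update (x + Pi.single j 1) j t = Function.update x j t := by
    intro t; funext l
    by_cases hl : l = j
    · subst hl; simp
    · simp [hl]
  by_cases hj : j ∈ S
  · simp only [hj, if_true, Finset.mem_erase, ne_eq, not_true, false_and, if_false, add_zero,
      Finset.insert_erase hj, sgn_erase_self, e2, Pi.add_apply, Pi.single_eq_same]
    rw [← mul_sub, ← mul_assoc, sgn_mul_self, one_mul]
  · have e1 : ∀ t, Function.update x j t + Pi.single j 1 = Function.update x j (t + 1) := by
      intro t; funext l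
      by_cases hl : l = j
      · subst hl; simp
      · simp [hl]
    have e4 : ∀ (a : ZMod q) (A : ℤ → ZMod q), I (fun t => a * A t) = a • I A := by
      intro a A
      rw [← map_smul]; rfl
    simp only [hj, if_false, Finset.mem_insert_self, if_true, zero_add,
      Finset.erase_insert hj, sgn_insert_self, e1, e4, Pi.smul_apply, smul_eq_mul]
    rw [← mul_assoc, sgn_mul_self, one_mul]

/-- The homotopy formula: all directions other than `j` cancel, and what remains is a one-variable
expression. A suitable `I` makes it the identity on the cells of interest. -/
lemma totalCoboundary_contraction (I : (ℤ → ZMod q) →ₗ[ZMod q] (ℤ → ZMod q)) (j : Fin d)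
    (F : TotalCochain d q) (x : Fin d → ℤ) (S : Finset (Fin d)) :
    totalCoboundary (contraction I j F) x S + contraction I j (totalCoboundary F) x S =
      if j ∈ S then I (fun t => F (Function.update x j t) S) (x j + 1) -
        I (fun t => F (Function.update x j t) S) (x j)
      else I (fun t => F (Function.update x j (t + 1)) S - F (Function.update x j t) S) (x j) := by
  rw [← dirCoboundary_contraction_self]
  have h : totalCoboundary (contraction I j F) + contraction I j (totalCoboundary F) =
      dirCoboundary j (contraction I j F) + contraction I j (dirCoboundary j F) := by
    simp only [totalCoboundary, LinearMap.sum_apply, map_sum]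
    rw [← Finset.sum_add_distrib]
    refine Finset.sum_eq_single j (fun i _ hi => ?_) (by simp)
    exact dirCoboundary_contraction_of_ne I hi F
  exact congrFun (congrFun h x) S

/-! ### Acyclicity of `ℤ^d` -/

/-- Discrete integration from `0`. -/
def integral (q : ℕ) : (ℤ → ZMod q) →ₗ[ZMod q] (ℤ → ZMod q) where
  toFun φ t := ∑ i ∈ Finset.range t.toNat, φ i - ∑ i ∈ Finset.range (-t).toNat, φ (-1 - i)
  map_add' φ ψ := by
    funext t; simp [Finset.sum_add_distrib]; ring
  map_smul' a φ := by
    funext t; simp [← Finset.mul_sum, mul_sub]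

lemma integral_succ_sub (φ : ℤ → ZMod q) (t : ℤ) :
    integral q φ (t + 1) - integral q φ t = φ t := by
  simp only [integral, LinearMap.coe_mk, AddHom.coe_mk]
  rcases lt_or_ge t 0 with h | h
  · obtain ⟨m, rfl⟩ : ∃ m : ℕ, t = -1 - m := ⟨(-1 - t).toNat, by omega⟩
    have e1 : (-(-1 - (m : ℤ))).toNat = m + 1 := by omega
    have e2 : (-(-1 - (m : ℤ) + 1)).toNat = m := by omega
    have e3 : (-1 - (m : ℤ) + 1).toNat = 0 := by omega
    have e4 : (-1 - (m : ℤ)).toNat = 0 := by omega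
    simp only [e1, e2, e3, e4, Finset.sum_range_succ]
    ring
  · obtain ⟨m, rfl⟩ : ∃ m : ℕ, t = m := ⟨t.toNat, by omega⟩
    have e1 : (-(m : ℤ)).toNat = 0 := by omega
    have e2 : (-((m : ℤ) + 1)).toNat = 0 := by omega
    have e3 : ((m : ℤ) + 1).toNat = m + 1 := by omega
    have e4 : (m : ℤ).toNat = m := by omega
    simp only [e1, e2, e3, e4, Finset.sum_range_succ]
    ring

/-- Directions are treated one after the other. Once those in `T` are done, the remainder vanishes
on each cell that extends in a direction of `T`; integrating it along a new direction `j` settles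
the cells extending along `j` and does not disturb the others. -/
lemma exists_totalCoboundary_eq (F : TotalCochain d q) (hF : totalCoboundary F = 0) :
    ∃ G : TotalCochain d q, ∀ x S, S.Nonempty → F x S = totalCoboundary G x S := by
  suffices h : ∀ T : Finset (Fin d), ∃ G : TotalCochain d q,
      ∀ x S, (T ∩ S).Nonempty → F x S = totalCoboundary G x S by
    obtain ⟨G, hG⟩ := h Finset.univ
    exact ⟨G, fun x S hS => hG x S (by simpa using hS)⟩
  intro T
  induction T using Finset.induction_on with
  | empty => exact ⟨0, by simp⟩
  | insert j T hj ih =>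
    obtain ⟨G, hG⟩ := ih
    set R := F - totalCoboundary G with hR
    have hR0 : totalCoboundary R = 0 := by
      rw [hR, map_sub, hF, totalCoboundary_totalCoboundary, sub_zero]
    refine ⟨G + contraction (integral q) j R, fun x S hS => ?_⟩
    have key := totalCoboundary_contraction (integral q) j R x S
    rw [hR0, map_zero, Pi.zero_apply, Pi.zero_apply, add_zero] at key
    suffices h : totalCoboundary (contraction (integral q) j R) x S = R x S by
      rw [map_add, Pi.add_apply, Pi.add_apply, h, hR]; simp
    rw [key]
    split_ifs with hjS
    · rw [integral_succ_sub, Function.update_eq_self]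
    · have hTS : (T ∩ S).Nonempty := by
        rwa [Finset.insert_inter_of_notMem hjS] at hS
      have hz : ∀ y, R y S = 0 := fun y => by simp [hR, hG y S hTS]
      simp only [hz, sub_zero]
      have : integral q (fun _ => 0) = 0 := map_zero _
      simp [this]

/-! ### Vanishing of relative cohomology of the cube below the top degree -/

/-- The open cell lies in the interior of `[-n, n]^d`. -/
def Inner (n : ℕ) (x : Fin d → ℤ) (S : Finset (Fin d)) : Prop :=
  ∀ j, x j < n ∧ (if j ∈ S then -(n : ℤ) ≤ x j else -(n : ℤ) < x j)

/-- Discrete integration from `-n`, cut off at `n`. -/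
def cutIntegral (q n : ℕ) : (ℤ → ZMod q) →ₗ[ZMod q] (ℤ → ZMod q) where
  toFun φ t := if t < n then ∑ i ∈ Finset.range (t + n).toNat, φ (-n + i) else 0
  map_add' φ ψ := by
    funext t; by_cases h : t < n <;> simp [h, Finset.sum_add_distrib]
  map_smul' a φ := by
    funext t; by_cases h : t < n <;> simp [h, ← Finset.mul_sum]

lemma cutIntegral_apply (n : ℕ) (φ : ℤ → ZMod q) (t : ℤ) : cutIntegral q n φ t =
    if t < n then ∑ i ∈ Finset.range (t + n).toNat, φ (-n + i) else 0 := rfl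

lemma cutIntegral_diff (n : ℕ) (φ : ℤ → ZMod q) (h : ∀ t : ℤ, t ≤ -n ∨ n ≤ t → φ t = 0) (t : ℤ) :
    cutIntegral q n (fun t => φ (t + 1) - φ t) t = φ t := by
  rw [cutIntegral_apply]
  split_ifs with ht
  · have := Finset.sum_range_sub (fun i : ℕ => φ (-n + i)) (t + n).toNat
    simp only [Nat.cast_add, Nat.cast_one, ← add_assoc, Nat.cast_zero, add_zero] at this
    rw [this, h (-n) (Or.inl le_rfl), sub_zero]
    rcases le_or_gt t (-n) with h' | h'
    · rw [h t (Or.inl h')]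
      exact h _ (Or.inl (by omega))
    · congr 1; omega
  · exact (h t (Or.inr (by omega))).symm

/-- The integral is an empty sum at or below `-n` and is cut off from `n` on, so integrating in
direction `j` does not leave the open cube. -/
lemma contraction_cutIntegral_eq_zero {n : ℕ} {F : TotalCochain d q}
    (hF : ∀ x S, ¬ Inner n x S → F x S = 0) (j : Fin d) (x : Fin d → ℤ) (S : Finset (Fin d))
    (h : ¬ Inner n x S) : contraction (cutIntegral q n) j F x S = 0 := by
  rw [contraction_apply]
  split_ifs with hj
  · rfl
  rw [cutIntegral_apply]
  split_ifs with hx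
  · rw [Finset.sum_eq_zero, mul_zero]
    intro i hi
    apply hF
    intro hin
    apply h
    intro l
    have := hin l
    by_cases hl : l = j
    · subst hl
      simp only [Finset.mem_range] at hi
      simp only [hj, if_false]
      omega
    · simpa [hl] using this
  · simp

lemma totalCoboundary_eq_zero_of_not_inner {n : ℕ} {F : TotalCochain d q}
    (hF : ∀ x S, ¬ Inner n x S → F x S = 0) (x : Fin d → ℤ) (S : Finset (Fin d))
    (h : ¬ Inner n x S) : totalCoboundary F x S = 0 := by
  rw [totalCoboundary_apply]
  refine Finset.sum_eq_zero fun j _ => ?_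
  rw [dirCoboundary_apply]
  split_ifs with hj
  · rw [hF, hF, sub_zero, mul_zero]
    · contrapose! h
      intro l
      have := h l
      by_cases hl : l = j
      · subst hl; simp at this; simp [hj]; omega
      · simpa [hl] using this
    · contrapose! h
      intro l
      have := h l
      by_cases hl : l = j
      · subst hl; simp at this; simp [hj]; omega
      · simpa [hl] using this
  · rfl

/-- The induction runs opposite to the absolute case: with zero values at both ends, integration
inverts the difference operator on cells that do not extend in direction `j` (`cutIntegral_diff`).
After all directions only the full-dimensional cells remain, and these carry the relative cohomology
of the cube. -/
lemma exists_totalCoboundary_eq_of_inner {n : ℕ} (F : TotalCochain d q)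
    (hF : ∀ x S, ¬ Inner n x S → F x S = 0) (hF0 : totalCoboundary F = 0) :
    ∃ G : TotalCochain d q, (∀ x S, ¬ Inner n x S → G x S = 0) ∧
      ∀ x S, S ≠ Finset.univ → F x S = totalCoboundary G x S := by
  suffices h : ∀ T : Finset (Fin d), ∃ G : TotalCochain d q, (∀ x S, ¬ Inner n x S → G x S = 0) ∧
      ∀ x S, ¬ T ⊆ S → F x S = totalCoboundary G x S by
    obtain ⟨G, hG0, hG⟩ := h Finset.univ
    exact ⟨G, hG0, fun x S hS => hG x S (by simpa [Finset.univ_subset_iff] using hS)⟩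
  intro T
  induction T using Finset.induction_on with
  | empty => exact ⟨0, by simp, by simp⟩
  | insert j T hj ih =>
    obtain ⟨G, hG0, hG⟩ := ih
    set R := F - totalCoboundary G with hR
    have hR0 : totalCoboundary R = 0 := by
      rw [hR, map_sub, hF0, totalCoboundary_totalCoboundary, sub_zero]
    have hRin : ∀ x S, ¬ Inner n x S → R x S = 0 := fun x S h => by
      simp [hR, hF x S h, totalCoboundary_eq_zero_of_not_inner hG0 x S h]
    refine ⟨G + contraction (cutIntegral q n) j R, fun x S h => ?_, fun x S hS => ?_⟩
    · rw [Pi.add_apply, Pi.add_apply, hG0 x S h, contraction_cutIntegral_eq_zero hRin j x S h,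
        add_zero]
    have key := totalCoboundary_contraction (cutIntegral q n) j R x S
    rw [hR0, map_zero, Pi.zero_apply, Pi.zero_apply, add_zero] at key
    suffices h : totalCoboundary (contraction (cutIntegral q n) j R) x S = R x S by
      rw [map_add, Pi.add_apply, Pi.add_apply, h, hR]; simp
    rw [key]
    split_ifs with hjS
    · have hTS : ¬ T ⊆ S := fun h => hS (Finset.insert_subset hjS h)
      have hz : ∀ y, R y S = 0 := fun y => by simp [hR, hG y S hTS]
      have : cutIntegral q n (fun _ => 0) = 0 := map_zero _
      simp [hz, this]
    · have := cutIntegral_diff n (fun t => R (Function.update x j t) S) (fun t ht => by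
        refine hRin _ _ fun hin => ?_
        have := hin j
        simp only [Function.update_self, hjS, if_false] at this
        omega) (x j)
      rw [this, Function.update_eq_self]

/-! ### Pulling back along the retraction onto a cube -/

/-- The nearest point of the cube `[-n, n]^d`. -/
def clamp (n : ℕ) (x : Fin d → ℤ) : Fin d → ℤ := fun j => max (-n) (min n (x j))

open Classical in
/-- The pullback of a cochain along the retraction of `ℤ^d` onto `[-n, n]^d`. -/
def retract (n : ℕ) (F : TotalCochain d q) : TotalCochain d q := fun x S =>
  if ∀ j ∈ S, -(n : ℤ) ≤ x j ∧ x j < n then F (clamp n x) S else 0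

/-- The retraction is cellular: it maps a cell to a cell of the cube or collapses one of its
directions, and collapsed cells contribute zero. -/
lemma totalCoboundary_retract (n : ℕ) (F : TotalCochain d q) :
    totalCoboundary (retract n F) = retract n (totalCoboundary F) := by
  classical
  funext x S
  rw [retract, totalCoboundary_apply, totalCoboundary_apply]
  split_ifs with h
  · refine Finset.sum_congr rfl fun j _ => ?_
    rw [dirCoboundary_apply, dirCoboundary_apply]
    split_ifs with hj
    · have hS : ∀ i ∈ S.erase j, -(n : ℤ) ≤ x i ∧ x i < n := fun i hi =>
        h i (Finset.mem_of_mem_erase hi)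
      have hS' : ∀ i ∈ S.erase j, -(n : ℤ) ≤ (x + Pi.single j 1 : Fin d → ℤ) i ∧
          (x + Pi.single j 1 : Fin d → ℤ) i < n := fun i hi => by
        simpa [Finset.ne_of_mem_erase hi] using hS i hi
      rw [retract, retract, if_pos hS, if_pos hS']
      congr 3
      funext i
      by_cases hi : i = j
      · subst hi
        have := h i hj
        simp [clamp]; omega
      · simp [clamp, hi]
    · rfl
  · push Not at h
    obtain ⟨i, hi, hin⟩ := h
    refine Finset.sum_eq_zero fun j _ => ?_
    rw [dirCoboundary_apply]
    split_ifs with hj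
    · by_cases hij : i = j
      -- In the collapsed direction the two opposite faces have the same image and cancel; in the
      -- other directions the faces are still collapsed.
      · subst hij
        rw [mul_eq_zero_of_right]
        rw [sub_eq_zero]
        unfold retract
        have e : clamp n (x + Pi.single i 1) = clamp n x := by
          funext l
          by_cases hl : l = i
          · subst hl; simp [clamp]; omega
          · simp [clamp, hl]
        rw [e]
        refine if_congr ?_ rfl rfl
        refine forall₂_congr fun l hl => ?_
        simp [Finset.ne_of_mem_erase hl]
      · rw [retract, retract, if_neg, if_neg, sub_zero, mul_zero]
        · intro h
          have := h i (by simp [hij, hi])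
          omega
        · intro h
          have := h i (by simp [hij, hi])
          simp [hij] at this
          omega
    · rfl

end TotalCochains

variable {d k q : ℕ}

/-! ### Cochains of one degree -/

/-- A cochain of degree `k`, seen as a total cochain. -/
def toTotal (f : Cochain d k q) : TotalCochain d q :=
  fun x S => if h : S.card = k then f (x, ⟨S, h⟩) else 0

/-- The part of degree `k` of a total cochain. -/
def ofTotal (k : ℕ) (F : TotalCochain d q) : Cochain d k q := fun σ => F σ.1 σ.2.1

lemma ofTotal_toTotal (f : Cochain d k q) : ofTotal k (toTotal f) = f := by
  funext σ
  simp [ofTotal, toTotal, σ.2.2]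

lemma evalChain_eq_linearCombination (f : Cochain d k q) (γ : Chain d k q) :
    evalChain f γ = Finsupp.linearCombination (ZMod q) f γ := rfl

lemma evalChain_add (f : Cochain d k q) (γ η : Chain d k q) :
    evalChain f (γ + η) = evalChain f γ + evalChain f η := by
  simp [evalChain_eq_linearCombination]

lemma evalChain_add_left (f g : Cochain d k q) (γ : Chain d k q) :
    evalChain (f + g) γ = evalChain f γ + evalChain g γ := by
  simp [evalChain, Finsupp.sum, mul_add, Finset.sum_add_distrib]

lemma evalChain_congr {f g : Cochain d k q} {γ : Chain d k q} (h : ∀ σ ∈ γ.support, f σ = g σ) :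
    evalChain f γ = evalChain g γ :=
  Finset.sum_congr rfl fun σ hσ => congrArg (γ σ * ·) (h σ hσ)

lemma evalChain_eq_zero {f : Cochain d k q} {γ : Chain d k q} (h : ∀ σ ∈ γ.support, f σ = 0) :
    evalChain f γ = 0 :=
  Finset.sum_eq_zero fun σ hσ => mul_eq_zero_of_right _ (h σ hσ)

lemma coboundary_apply (f : Cochain d k q) (σ : Cell d (k + 1)) :
    coboundary f σ = ∑ j : {j // j ∈ σ.2.1},
      sgn q σ.2.1 j * (f (σ.upperFace j) - f (σ.lowerFace j)) := by
  change evalChain f (cellBoundary q σ) = _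
  rw [evalChain_eq_linearCombination, cellBoundary, map_sum]
  refine Finset.sum_congr rfl fun j _ => ?_
  simp [sgn]

lemma coboundary_ofTotal (F : TotalCochain d q) :
    coboundary (ofTotal k F) = ofTotal (k + 1) (totalCoboundary F) := by
  funext σ
  rw [coboundary_apply, ofTotal, totalCoboundary_apply]
  simp only [dirCoboundary_apply]
  rw [Finset.sum_ite_mem, Finset.univ_inter, ← Finset.sum_coe_sort σ.2.1]
  rfl

lemma totalCoboundary_toTotal (f : Cochain d k q) :
    totalCoboundary (toTotal f) = toTotal (coboundary f) := by
  funext x S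
  by_cases h : S.card = k + 1
  · rw [← ofTotal_toTotal f, coboundary_ofTotal, ofTotal_toTotal, toTotal, dif_pos h]
    rfl
  · rw [toTotal, dif_neg h, totalCoboundary_apply]
    refine Finset.sum_eq_zero fun j _ => ?_
    rw [dirCoboundary_apply]
    split_ifs with hj
    · have : (S.erase j).card ≠ k := fun h' => h (by
        rw [← Finset.card_erase_add_one hj, h'])
      simp [toTotal, this]
    · rfl

lemma coboundary_coboundary (f : Cochain d k q) : coboundary (coboundary f) = 0 := by
  rw [← ofTotal_toTotal f, coboundary_ofTotal, coboundary_ofTotal,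
    totalCoboundary_totalCoboundary]
  rfl

lemma coboundary_one : coboundary (fun _ : Cell d 0 => (1 : ZMod q)) = 0 := by
  funext σ
  rw [coboundary_apply]
  simp

lemma evalChain_boundary (f : Cochain d k q) (τ : Chain d (k + 1) q) :
    evalChain f (boundary τ) = evalChain (coboundary f) τ := by
  simp only [evalChain_eq_linearCombination, boundary]
  rw [← LinearMap.comp_apply]
  congr 1
  ext σ
  simp [coboundary, evalChain_eq_linearCombination]

lemma evalChain_indicator (σ : Cell d k) (γ : Chain d k q) :
    evalChain (Pi.single σ 1) γ = γ σ := by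
  classical
  rw [evalChain, Finsupp.sum_eq_single σ]
  · simp
  · intro τ _ h; simp [h]
  · simp

lemma isCycle_boundary (τ : Chain d (k + 1) q) : IsCycle (boundary τ) := by
  cases k with
  | zero =>
    have : evalChain (fun _ => 1) (boundary τ) = 0 := by
      rw [evalChain_boundary, coboundary_one]
      exact evalChain_eq_zero fun _ _ => rfl
    simpa [evalChain, IsCycle] using this
  | succ k =>
    change boundary (boundary τ) = 0
    ext σ
    rw [← evalChain_indicator, evalChain_boundary, evalChain_boundary, coboundary_coboundary]
    exact evalChain_eq_zero fun _ _ => rfl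

/-! ### Cells and cubes -/

lemma Cell.inner_iff {N : ℕ} (σ : Cell d k) :
    Inner N σ.1 σ.2.1 ↔ σ.InBox N ∧ ¬ σ.InBdry N := by
  constructor
  · intro h
    refine ⟨fun j => ?_, fun ⟨_, j, hj, hj'⟩ => ?_⟩
    · have := h j
      by_cases hj : j ∈ σ.2.1 <;> simp only [hj, if_true, if_false] at this ⊢ <;> omega
    · have := h j
      simp only [hj, if_false] at this
      omega
  · rintro ⟨h, h'⟩ j
    have := h j
    by_cases hj : j ∈ σ.2.1 <;> simp only [hj, if_true, if_false] at this ⊢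
    · omega
    · have : ¬ (σ.1 j = -(N : ℤ) ∨ σ.1 j = (N : ℤ)) := fun h'' => h' ⟨h, j, hj, h''⟩
      omega

lemma Inner.mono {n N : ℕ} (h : n ≤ N) {x : Fin d → ℤ} {S : Finset (Fin d)} (hi : Inner n x S) :
    Inner N x S := by
  intro j
  have := hi j
  by_cases hj : j ∈ S <;> simp only [hj, if_true, if_false] at this ⊢ <;> omega

lemma Cell.InBox.mono {n N : ℕ} (h : n ≤ N) {σ : Cell d k} (hi : σ.InBox n) : σ.InBox N := by
  intro j
  have := hi j
  omega

lemma Cell.exists_inner (σ : Cell d k) : ∃ n : ℕ, Inner n σ.1 σ.2.1 := by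
  refine ⟨∑ j, (σ.1 j).natAbs + 1, fun j => ?_⟩
  have : (σ.1 j).natAbs ≤ ∑ j, (σ.1 j).natAbs :=
    Finset.single_le_sum (f := fun j => (σ.1 j).natAbs) (fun _ _ => Nat.zero_le _)
      (Finset.mem_univ j)
  by_cases hj : j ∈ σ.2.1 <;> simp only [hj, if_true, if_false] <;> omega

lemma exists_forall_inner (J : Finset (Cell d k)) :
    ∃ n : ℕ, ∀ N ≥ n, ∀ σ ∈ J, Inner N σ.1 σ.2.1 := by
  choose m hm using fun σ : Cell d k => σ.exists_inner
  exact ⟨J.sup m, fun N hN σ hσ => (hm σ).mono ((Finset.le_sup hσ).trans hN)⟩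

lemma Cell.InBox.lowerFace {N : ℕ} {σ : Cell d (k + 1)} (h : σ.InBox N) (j : {j // j ∈ σ.2.1}) :
    (σ.lowerFace j).InBox N := by
  intro i
  have := h i
  by_cases hij : i = j.1
  · subst hij
    simp [Cell.lowerFace, j.2] at this ⊢; omega
  · simpa [Cell.lowerFace, hij] using this

lemma Cell.InBox.upperFace {N : ℕ} {σ : Cell d (k + 1)} (h : σ.InBox N) (j : {j // j ∈ σ.2.1}) :
    (σ.upperFace j).InBox N := by
  intro i
  have := h i
  by_cases hij : i = j.1
  · subst hij
    simp [Cell.upperFace, j.2] at this ⊢; omega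
  · simpa [Cell.upperFace, hij] using this

lemma Cell.InBdry.lowerFace {N : ℕ} {σ : Cell d (k + 1)} (h : σ.InBdry N)
    (j : {j // j ∈ σ.2.1}) : (σ.lowerFace j).InBdry N := by
  refine ⟨h.1.lowerFace j, ?_⟩
  obtain ⟨i, hi, hi'⟩ := h.2
  exact ⟨i, by simp [Cell.lowerFace, hi], hi'⟩

lemma Cell.InBdry.upperFace {N : ℕ} {σ : Cell d (k + 1)} (h : σ.InBdry N)
    (j : {j // j ∈ σ.2.1}) : (σ.upperFace j).InBdry N := by
  refine ⟨h.1.upperFace j, ?_⟩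
  obtain ⟨i, hi, hi'⟩ := h.2
  refine ⟨i, by simp [Cell.upperFace, hi], ?_⟩
  have : i ≠ j.1 := fun h => hi (h ▸ j.2)
  simpa [Cell.upperFace, this] using hi'

lemma coboundary_congr {f g : Cochain d k q} {σ : Cell d (k + 1)}
    (hl : ∀ j, f (σ.lowerFace j) = g (σ.lowerFace j))
    (hu : ∀ j, f (σ.upperFace j) = g (σ.upperFace j)) : coboundary f σ = coboundary g σ := by
  simp only [coboundary_apply, hl, hu]

lemma coboundary_congr_of_inBox {N : ℕ} {f g : Cochain d k q}
    (h : ∀ σ : Cell d k, σ.InBox N → f σ = g σ) {σ : Cell d (k + 1)} (hσ : σ.InBox N) :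
    coboundary f σ = coboundary g σ :=
  coboundary_congr (fun j => h _ (hσ.lowerFace j)) fun j => h _ (hσ.upperFace j)

lemma inBdry_of_mem_support_boundary {N : ℕ} {τ : Chain d (k + 1) q}
    (h : ∀ σ ∈ τ.support, σ.InBdry N) : ∀ σ ∈ (boundary τ).support, σ.InBdry N := by
  intro σ hσ
  by_contra hn
  refine Finsupp.mem_support_iff.1 hσ ?_
  rw [← evalChain_indicator, evalChain_boundary]
  refine evalChain_eq_zero fun ρ hρ => ?_
  rw [coboundary_congr (g := 0), map_zero, Pi.zero_apply]
  · intro j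
    exact Pi.single_eq_of_ne (fun e => hn (by rw [← e]; exact (h ρ hρ).lowerFace j)) _
  · intro j
    exact Pi.single_eq_of_ne (fun e => hn (by rw [← e]; exact (h ρ hρ).upperFace j)) _

/-! ### Retraction onto a cube for cochains of one degree -/

/-- The pullback of a cochain along the retraction of `ℤ^d` onto `[-n, n]^d`. -/
def retractCochain (n : ℕ) (f : Cochain d k q) : Cochain d k q := ofTotal k (retract n (toTotal f))

lemma coboundary_retractCochain (n : ℕ) (f : Cochain d k q) :
    coboundary (retractCochain n f) = retractCochain n (coboundary f) := by
  rw [retractCochain, coboundary_ofTotal, totalCoboundary_retract, totalCoboundary_toTotal]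
  rfl

lemma retractCochain_apply_of_inBox {n : ℕ} (f : Cochain d k q) {σ : Cell d k} (h : σ.InBox n) :
    retractCochain n f σ = f σ := by
  have hc : clamp n σ.1 = σ.1 := by
    funext j
    have := h j
    by_cases hj : j ∈ σ.2.1 <;> simp only [hj, if_true, if_false, clamp] at this ⊢ <;> omega
  have hr : ∀ j ∈ σ.2.1, -(n : ℤ) ≤ σ.1 j ∧ σ.1 j < n := by
    intro j hj
    have := h j
    simp only [hj, if_true] at this
    omega
  rw [retractCochain, ofTotal, retract, if_pos hr, hc, toTotal, dif_pos σ.2.2]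

/-- A cell that is not interior to the cube is either collapsed by the retraction or moved onto a
cell of the boundary. -/
lemma retractCochain_eq_zero {n : ℕ} {f : Cochain d k q}
    (hf : ∀ σ : Cell d k, σ.InBdry n → f σ = 0) {σ : Cell d k} (h : ¬ Inner n σ.1 σ.2.1) :
    retractCochain n f σ = 0 := by
  rw [retractCochain, ofTotal, retract]
  split_ifs with hr
  · rw [toTotal, dif_pos σ.2.2]
    refine hf _ ⟨fun j => ?_, ?_⟩
    · by_cases hj : j ∈ σ.2.1
      · have := hr j hj
        simp only [hj, if_true, clamp]; omega
      · simp only [hj, if_false, clamp]; omega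
    · simp only [Inner, not_forall] at h
      obtain ⟨j, hj⟩ := h
      by_cases hjS : j ∈ σ.2.1
      · have := hr j hjS
        simp only [hjS, if_true] at hj
        omega
      · simp only [hjS, if_false] at hj
        refine ⟨j, hjS, ?_⟩
        simp only [clamp]
        omega
  · rfl

/-! ### Cohomology of `ℤ^d` and of the boundary of a cube -/

lemma cochain_zero_eq_const {f : Cochain d 0 q} (hf : coboundary f = 0) (σ τ : Cell d 0) :
    f σ = f τ := by
  have hE : ∀ x : Fin d → ℤ, ∀ S : {S : Finset (Fin d) // S.card = 0}, f (x, S) =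
      f (x, ⟨∅, Finset.card_empty⟩) := by
    rintro x ⟨S, hS⟩
    obtain rfl := Finset.card_eq_zero.1 hS
    rfl
  -- The periods of `f` form a subgroup of `ℤ^d`; vanishing of the coboundary on edges puts the unit
  -- vectors into it.
  let P : AddSubgroup (Fin d → ℤ) :=
    { carrier := {v | ∀ x, f (x + v, ⟨∅, Finset.card_empty⟩) = f (x, ⟨∅, Finset.card_empty⟩)}
      zero_mem' := by simp
      add_mem' := fun {v w} hv hw x => by rw [← add_assoc, hw, hv]
      neg_mem' := fun {v} hv x => by rw [← hv (x + -v)]; simp }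
  have hs : ∀ j, (Pi.single j 1 : Fin d → ℤ) ∈ P := by
    intro j x
    have h := congrFun hf (x, ⟨{j}, by simp⟩)
    rw [coboundary_apply] at h
    have : Unique {i // i ∈ ({j} : Finset (Fin d))} :=
      ⟨⟨j, by simp⟩, fun i => Subtype.ext (Finset.mem_singleton.1 i.2)⟩
    rw [Fintype.sum_unique] at h
    have hd : (default : {i // i ∈ ({j} : Finset (Fin d))}).1 = j := by
      exact Finset.mem_singleton.1 (default : {i // i ∈ ({j} : Finset (Fin d))}).2
    simp only [Cell.upperFace, Cell.lowerFace, hE, Pi.zero_apply, hd] at h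
    have h2 := congrArg (sgn q {j} j * ·) h
    simp only [← mul_assoc, sgn_mul_self, one_mul, mul_zero] at h2
    exact sub_eq_zero.1 h2
  have hall : ∀ v : Fin d → ℤ, v ∈ P := by
    intro v
    have : v = ∑ j, v j • (Pi.single j 1 : Fin d → ℤ) := by
      funext i; simp [Finset.sum_apply, Pi.single_apply]
    rw [this]
    exact P.sum_mem fun j _ => P.zsmul_mem (hs j) _
  have h0 : ∀ ρ : Cell d 0, f ρ = f (0, ⟨∅, Finset.card_empty⟩) := by
    intro ρ
    rw [← hall ρ.1 0, zero_add, ← hE ρ.1 ρ.2]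
  rw [h0 σ, h0 τ]

/-- The reduced cohomology of `ℤ^d` vanishes: cocycles are zero on cycles. -/
lemma evalChain_eq_zero_of_cocycle {f : Cochain d k q} (hf : coboundary f = 0) {c : Chain d k q}
    (hc : IsCycle c) : evalChain f c = 0 := by
  cases k with
  | zero =>
    have h : evalChain f c = (c.sum fun _ a => a) * f (0, ⟨∅, Finset.card_empty⟩) := by
      rw [evalChain, Finsupp.sum_mul]
      exact Finset.sum_congr rfl fun σ _ => congrArg (c σ * ·) (cochain_zero_eq_const hf σ _)
    rw [h, show (c.sum fun _ a => a) = 0 from hc, zero_mul]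
  | succ k =>
    obtain ⟨G, hG⟩ := exists_totalCoboundary_eq (toTotal f) (by
      rw [totalCoboundary_toTotal, hf]; funext x S; simp [toTotal])
    have hfG : f = coboundary (ofTotal k G) := by
      rw [coboundary_ofTotal]
      funext σ
      have := hG σ.1 σ.2.1 (Finset.card_pos.1 (by rw [σ.2.2]; omega))
      rw [ofTotal, ← this, toTotal, dif_pos σ.2.2]
    rw [hfG, ← evalChain_boundary, show boundary c = 0 from hc]
    exact evalChain_eq_zero (by simp)

/-- The reduced cohomology of the boundary of a cube vanishes below the top degree: cochains which
are cocycles on the boundary are zero on its cycles. -/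
lemma evalChain_eq_zero_of_cocycle_bdry (hk : k + 1 < d) {n : ℕ} {f : Cochain d k q}
    (hf : ∀ σ : Cell d (k + 1), σ.InBdry n → coboundary f σ = 0) {c : Chain d k q}
    (hc : IsCycle c) (hcs : ∀ σ ∈ c.support, σ.InBdry n) : evalChain f c = 0 := by
  classical
  -- `F` extends `f` from the boundary: outwards by the retraction, inwards by zero. Its coboundary
  -- lives on interior cells and has degree below `d`, so it is the coboundary of some `G` supported
  -- on interior cells. Then `F - G` is a cocycle on all of `ℤ^d` that still equals `f` on the
  -- boundary.
  let F : Cochain d k q := fun σ => if Inner n σ.1 σ.2.1 then 0 else retractCochain n f σ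
  have hδF : ∀ σ : Cell d (k + 1), ¬ Inner n σ.1 σ.2.1 → coboundary F σ = 0 := by
    intro σ hσ
    have hl : ∀ j, ¬ Inner n (σ.lowerFace j).1 (σ.lowerFace j).2.1 := by
      refine fun j h => hσ fun i => ?_
      have := h i
      by_cases hij : i = j.1
      · subst hij
        simp only [Cell.lowerFace, Finset.notMem_erase, if_false, j.2, if_true] at this ⊢
        omega
      · simpa [Cell.lowerFace, hij] using this
    have hu : ∀ j, ¬ Inner n (σ.upperFace j).1 (σ.upperFace j).2.1 := by
      refine fun j h => hσ fun i => ?_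
      have := h i
      by_cases hij : i = j.1
      · subst hij
        simp only [Cell.upperFace, Finset.notMem_erase, if_false, j.2, if_true, Pi.add_apply,
          Pi.single_eq_same] at this ⊢
        omega
      · simpa [Cell.upperFace, hij] using this
    rw [coboundary_congr (g := retractCochain n f) (fun j => if_neg (hl j))
      (fun j => if_neg (hu j)), coboundary_retractCochain]
    exact retractCochain_eq_zero hf hσ
  obtain ⟨G, hG0, hG⟩ := exists_totalCoboundary_eq_of_inner (n := n) (toTotal (coboundary F))
    (fun x S h => by
      rw [toTotal]
      split_ifs with hS
      · exact hδF (x, ⟨S, hS⟩) h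
      · rfl)
    (by rw [totalCoboundary_toTotal, coboundary_coboundary]; funext x S; simp [toTotal])
  have hcoc : coboundary (F - ofTotal k G) = 0 := by
    rw [map_sub, coboundary_ofTotal, sub_eq_zero]
    funext σ
    have := hG σ.1 σ.2.1 (fun h => by
      have h1 := σ.2.2
      rw [h, Finset.card_univ, Fintype.card_fin] at h1
      omega)
    rw [ofTotal, ← this, toTotal, dif_pos σ.2.2]
  rw [← evalChain_eq_zero_of_cocycle hcoc hc]
  refine evalChain_congr fun σ hσ => ?_
  have hb := hcs σ hσ
  have hi : ¬ Inner n σ.1 σ.2.1 := fun h => (σ.inner_iff.1 h).2 hb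
  simp only [Pi.sub_apply, F, if_neg hi, ofTotal, hG0 _ _ hi, sub_zero,
    retractCochain_apply_of_inBox f hb.1]

/-! ### Duality over `ℤ/q` -/

/-- The embedding of `ℤ/q` into `ℚ/ℤ` that sends `1` to `1/q`. -/
def zmodToCircle (q : ℕ) [NeZero q] : ZMod q →+ AddCircle (1 : ℚ) :=
  ZMod.lift q ⟨zmultiplesHom _ (((1 : ℚ) / q : ℚ) : AddCircle (1 : ℚ)), by
    have hq : (q : ℚ) ≠ 0 := Nat.cast_ne_zero.2 (NeZero.ne q)
    simp only [zmultiplesHom_apply]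
    rw [← AddCircle.coe_zsmul, AddCircle.coe_eq_zero_iff]
    exact ⟨1, by simp [hq]⟩⟩

lemma zmodToCircle_intCast (q : ℕ) [NeZero q] (m : ℤ) :
    zmodToCircle q m = (((m : ℚ) / q : ℚ) : AddCircle (1 : ℚ)) := by
  rw [zmodToCircle, ZMod.lift_coe]
  simp only [zmultiplesHom_apply]
  rw [← AddCircle.coe_zsmul]
  congr 1
  simp [div_eq_mul_inv]

lemma zmodToCircle_injective (q : ℕ) [NeZero q] : Function.Injective (zmodToCircle q) := by
  have hq : (q : ℚ) ≠ 0 := Nat.cast_ne_zero.2 (NeZero.ne q)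
  rw [injective_iff_map_eq_zero]
  intro a ha
  obtain ⟨m, rfl⟩ := ZMod.intCast_surjective a
  rw [zmodToCircle_intCast, AddCircle.coe_eq_zero_iff] at ha
  obtain ⟨n, hn⟩ := ha
  rw [ZMod.intCast_zmod_eq_zero_iff_dvd]
  refine ⟨n, ?_⟩
  have : (m : ℚ) = q * n := by
    rw [eq_div_iff hq] at hn
    rw [← hn]; simp [mul_comm]
  exact_mod_cast this

lemma mem_range_zmodToCircle [NeZero q] {u : AddCircle (1 : ℚ)} (hu : q • u = 0) :
    u ∈ (zmodToCircle q).range := by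
  have hq : (q : ℚ) ≠ 0 := Nat.cast_ne_zero.2 (NeZero.ne q)
  obtain ⟨r, rfl⟩ := QuotientAddGroup.mk_surjective u
  change q • ((r : ℚ) : AddCircle (1 : ℚ)) = 0 at hu
  rw [← AddCircle.coe_nsmul, AddCircle.coe_eq_zero_iff] at hu
  obtain ⟨m, hm⟩ := hu
  refine ⟨(m : ZMod q), ?_⟩
  rw [zmodToCircle_intCast]
  congr 1
  simp only [zsmul_eq_mul, mul_one, nsmul_eq_mul] at hm
  rw [hm]; field_simp

/-- Linear functionals separate the points of a module over `ℤ/q`. -/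
lemma exists_functional_ne_zero [NeZero q] {M : Type*} [AddCommGroup M] [Module (ZMod q) M] {x : M}
    (hx : x ≠ 0) : ∃ l : M →ₗ[ZMod q] ZMod q, l x ≠ 0 := by
  obtain ⟨c, hc⟩ := CharacterModule.exists_character_apply_ne_zero_of_ne_zero hx
  -- The module is killed by `q`, so its characters take values in the `q`-torsion of `ℚ/ℤ`, which
  -- is a copy of `ℤ/q`.
  have hr : ∀ y, c y ∈ (zmodToCircle q).range := fun y => mem_range_zmodToCircle (by
    rw [← map_nsmul, ← Nat.cast_smul_eq_nsmul (ZMod q)]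
    simp)
  let e := AddMonoidHom.ofInjective (zmodToCircle_injective q)
  let l : M →+ ZMod q := e.symm.toAddMonoidHom.comp
    ((c : M →+ AddCircle (1 : ℚ)).codRestrict (zmodToCircle q).range hr)
  refine ⟨AddMonoidHom.toZModLinearMap q l, fun h => hc ?_⟩
  have h0 : e.symm ⟨c x, hr x⟩ = 0 := h
  rw [EmbeddingLike.map_eq_zero_iff] at h0
  exact congrArg Subtype.val h0

/-- The cochains whose coboundary vanishes on `A` vanish on `γ`. -/
def Annihilated (A : Set (Cell d (k + 1))) (γ : Chain d k q) : Prop :=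
  ∀ f : Cochain d k q, (∀ σ ∈ A, coboundary f σ = 0) → evalChain f γ = 0

/-- If `γ` is not in the span of the boundaries of cells of `A`, a linear functional on the quotient
detects it. Evaluated on cells, this functional is a cochain whose coboundary vanishes on `A`. -/
lemma annihilated_iff [NeZero q] {A : Set (Cell d (k + 1))} {γ : Chain d k q} :
    Annihilated A γ ↔ ∃ τ : Chain d (k + 1) q, (∀ σ ∈ τ.support, σ ∈ A) ∧ boundary τ = γ := by
  constructor
  · intro h
    let B := Submodule.span (ZMod q) (cellBoundary q '' A)
    have hγ : γ ∈ B := by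
      by_contra hγ
      have hx : B.mkQ γ ≠ 0 := fun h0 => hγ ((Submodule.Quotient.mk_eq_zero B).1 h0)
      obtain ⟨l, hl⟩ := exists_functional_ne_zero (q := q) hx
      have hev : ∀ η : Chain d k q,
          evalChain (fun σ => l (B.mkQ (Finsupp.single σ 1))) η = l (B.mkQ η) := by
        intro η
        rw [evalChain_eq_linearCombination, ← LinearMap.comp_apply]
        congr 1
        ext σ
        simp
      refine hl ?_
      rw [← LinearMap.comp_apply, LinearMap.comp_apply, ← hev]
      refine h _ fun σ hσ => ?_
      change evalChain _ (cellBoundary q σ) = 0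
      rw [hev, Submodule.mkQ_apply, (Submodule.Quotient.mk_eq_zero B).2, map_zero]
      exact Submodule.subset_span ⟨σ, hσ, rfl⟩
    obtain ⟨τ, hτ, h'⟩ := (Finsupp.mem_span_image_iff_linearCombination (ZMod q)).1 hγ
    exact ⟨τ, fun σ hσ => (Finsupp.mem_supported _ _).1 hτ hσ, h'⟩
  · rintro ⟨τ, hτ, rfl⟩ f hf
    rw [evalChain_boundary]
    exact evalChain_eq_zero fun σ hσ => hf σ (hτ σ hσ)

/-! ### The events `V_γ` in finite volume -/

/-- The plaquettes of the complex seen in the cube `[-n, n]^d`: those of `ω` in the interior,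
together with those in the boundary of the cube for wired boundary conditions. -/
def openPlaquettes (n : ℕ) (b : BC) (ω : Config d k) : Set (Cell d k) :=
  {σ | (Inner n σ.1 σ.2.1 ∧ ω σ = true) ∨ (b = .wired ∧ σ.InBdry n)}

/-- The event that `γ` bounds in the complex seen in the cube `[-n, n]^d`. -/
def localV (b : BC) (n : ℕ) (γ : Chain d k q) : Set (Config d (k + 1)) :=
  {ω | Annihilated (openPlaquettes n b ω) γ}

lemma Annihilated.mono {A B : Set (Cell d (k + 1))} {γ : Chain d k q} (h : A ⊆ B)
    (hA : Annihilated A γ) : Annihilated B γ :=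
  fun f hf => hA f fun σ hσ => hf σ (h hσ)

lemma isUpperSet_localV (b : BC) (n : ℕ) (γ : Chain d k q) : IsUpperSet (localV b n γ) := by
  intro ω ω' h hω
  refine Annihilated.mono (fun σ hσ => ?_) hω
  rcases hσ with hσ | hσ
  · exact Or.inl ⟨hσ.1, top_le_iff.1 (hσ.2.symm.le.trans (h σ))⟩
  · exact Or.inr hσ

lemma localV_congr (b : BC) (n : ℕ) (γ : Chain d k q) {ω ω' : Config d (k + 1)}
    (h : ∀ σ : Cell d (k + 1), Inner n σ.1 σ.2.1 → ω σ = ω' σ) :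
    ω ∈ localV b n γ ↔ ω' ∈ localV b n γ := by
  have : openPlaquettes n b ω = openPlaquettes n b ω' := by
    ext σ
    exact or_congr_left (and_congr_right fun hi => by rw [h σ hi])
  simp only [localV, Set.mem_ofPred_eq, this]

lemma localV_free_mono {n N : ℕ} (h : n ≤ N) (γ : Chain d k q) :
    localV .free n γ ⊆ localV .free N γ := by
  refine fun ω hω => Annihilated.mono (fun σ hσ => ?_) hω
  rcases hσ with hσ | hσ
  · exact Or.inl ⟨hσ.1.mono h, hσ.2⟩
  · exact absurd hσ.1 (by simp)

/-- A cochain that is closed on the boundary of the cube becomes, after pullback, closed on every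
cell that is not interior, whatever plaquettes are open there. -/
lemma coboundary_retractCochain_eq_zero {n : ℕ} {ω : Config d (k + 1)} {f : Cochain d k q}
    (hf : ∀ σ ∈ openPlaquettes n .wired ω, coboundary f σ = 0) {σ : Cell d (k + 1)}
    (hσ : Inner n σ.1 σ.2.1 → ω σ = true) : coboundary (retractCochain n f) σ = 0 := by
  rw [coboundary_retractCochain]
  by_cases hi : Inner n σ.1 σ.2.1
  · rw [retractCochain_apply_of_inBox _ (σ.inner_iff.1 hi).1]
    exact hf σ (Or.inl ⟨hi, hσ hi⟩)
  · exact retractCochain_eq_zero (fun σ hσ => hf σ (Or.inr ⟨rfl, hσ⟩)) hi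

lemma evalChain_retractCochain {n : ℕ} (f : Cochain d k q) {γ : Chain d k q}
    (h : ∀ σ ∈ γ.support, σ.InBox n) : evalChain (retractCochain n f) γ = evalChain f γ :=
  evalChain_congr fun σ hσ => retractCochain_apply_of_inBox f (h σ hσ)

lemma localV_wired_anti {n N : ℕ} (h : n ≤ N) {γ : Chain d k q}
    (hγ : ∀ σ ∈ γ.support, σ.InBox n) : localV .wired N γ ⊆ localV .wired n γ := by
  intro ω hω f hf
  rw [← evalChain_retractCochain f hγ]
  refine hω _ fun σ hσ => coboundary_retractCochain_eq_zero hf fun hi => ?_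
  rcases hσ with hσ | hσ
  · exact hσ.2
  · exact absurd hσ.2 (σ.inner_iff.1 (hi.mono h)).2

lemma V_free_eq_iUnion [NeZero q] (γ : Chain d k q) : V γ .free = ⋃ n, localV .free n γ := by
  ext ω
  simp only [V, VFin, Set.mem_ofPred_eq, Set.mem_iUnion, localV, annihilated_iff]
  constructor
  · rintro ⟨τ, hτ, h⟩
    obtain ⟨n, hn⟩ := exists_forall_inner τ.support
    exact ⟨n, τ, fun σ hσ => Or.inl ⟨hn n le_rfl σ hσ, hτ σ hσ⟩, h⟩
  · rintro ⟨n, τ, hτ, h⟩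
    refine ⟨τ, fun σ hσ => ?_, h⟩
    rcases hτ σ hσ with hσ | hσ
    · exact hσ.2
    · exact absurd hσ.1 (by simp)

/-- Left to right, a wired cocycle of the cube is pulled back along the retraction and evaluated on
`γ = ∂τ + c`: it vanishes on `∂τ` as a cocycle and on `c` by the cohomology of the boundary. The
shift by `n₀` discards cubes that may not contain `γ`. -/
lemma V_wired_eq_iInter [NeZero q] (hk : k + 1 < d) (γ : Chain d k q) {n₀ : ℕ}
    (hγ : ∀ σ ∈ γ.support, σ.InBox n₀) : V γ .wired = ⋂ n, localV .wired (n + n₀) γ := by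
  classical
  have hγ' : ∀ n ≥ n₀, ∀ σ ∈ γ.support, σ.InBox n := fun n hn σ hσ => (hγ σ hσ).mono hn
  ext ω
  simp only [V, Set.mem_iInter]
  constructor
  · rintro (⟨τ, hτ, h⟩ | h) n
    · intro f hf
      rw [← evalChain_retractCochain f (hγ' _ (Nat.le_add_left _ _)), ← h, evalChain_boundary]
      exact evalChain_eq_zero fun σ hσ =>
        coboundary_retractCochain_eq_zero hf fun _ => hτ σ hσ
    · obtain ⟨m, hm, c, hc, hcs, τ, hτ, hb⟩ := h (n + n₀)
      refine localV_wired_anti hm (hγ' _ (Nat.le_add_left _ _)) ?_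
      intro f hf
      have e : γ = boundary τ + c := by rw [hb]; simp
      rw [← evalChain_retractCochain f (hγ' m ((Nat.le_add_left _ _).trans hm)), e, evalChain_add,
        evalChain_boundary,
        evalChain_retractCochain f fun σ hσ => (hcs σ hσ).1,
        evalChain_eq_zero_of_cocycle_bdry hk (fun σ hσ => hf σ (Or.inr ⟨rfl, hσ⟩)) hc hcs, add_zero]
      exact evalChain_eq_zero fun σ hσ =>
        coboundary_retractCochain_eq_zero hf fun _ => hτ σ hσ
  · intro h
    refine Or.inr fun m => ⟨m + n₀, Nat.le_add_right _ _, ?_⟩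
    obtain ⟨τ, hτ, rfl⟩ := annihilated_iff.1 (h m)
    -- `τ` is split into its boundary plaquettes, whose boundary is the required cycle `c`, and its
    -- open interior plaquettes.
    refine ⟨boundary (τ.filter fun σ => σ.InBdry (m + n₀)), isCycle_boundary _,
      inBdry_of_mem_support_boundary fun σ hσ => ?_, τ.filter fun σ => ¬ σ.InBdry (m + n₀),
      fun σ hσ => ?_, ?_⟩
    · rw [Finsupp.support_filter, Finset.mem_filter] at hσ
      exact hσ.2
    · rw [Finsupp.support_filter, Finset.mem_filter] at hσ
      rcases hτ σ hσ.1 with h' | h'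
      · exact h'.2
      · exact absurd h'.2 hσ.2
    · rw [eq_sub_iff_add_eq, ← map_add, add_comm (Finsupp.filter _ _)]
      exact congrArg boundary (Finsupp.filter_add_filter_not _ _)

/-! ### Weak limits on compact spaces -/

section WeakLimit

variable {X : Type*} [TopologicalSpace X] [CompactSpace X] [MeasurableSpace X] [BorelSpace X]

lemma integrable_continuousMap (μ : ProbabilityMeasure X) (f : C(X, ℂ)) :
    Integrable f (μ : Measure X) :=
  (BoundedContinuousFunction.mkOfCompact f).integrable (μ : Measure X)

lemma norm_integral_sub_le (μ : ProbabilityMeasure X) (f g : C(X, ℂ)) :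
    ‖∫ x, f x ∂(μ : Measure X) - ∫ x, g x ∂(μ : Measure X)‖ ≤ ‖f - g‖ := by
  rw [← integral_sub (integrable_continuousMap μ f) (integrable_continuousMap μ g)]
  refine (norm_integral_le_of_norm_le_const (C := ‖f - g‖)
    (ae_of_all _ fun x => (f - g).norm_coe_le_norm x)).trans ?_
  simp

lemma isClosed_cauchySeq_integral (u : ℕ → ProbabilityMeasure X) :
    IsClosed {f : C(X, ℂ) | CauchySeq fun N => ∫ x, f x ∂(u N : Measure X)} := by
  refine isClosed_of_closure_subset fun f hf => ?_
  rw [Set.mem_ofPred_eq, Metric.cauchySeq_iff]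
  intro ε hε
  obtain ⟨g, hg, hfg⟩ := Metric.mem_closure_iff.1 hf (ε / 3) (by linarith)
  obtain ⟨M, hM⟩ := Metric.cauchySeq_iff.1 hg (ε / 3) (by linarith)
  refine ⟨M, fun m hm n hn => ?_⟩
  have h1 := norm_integral_sub_le (u m) f g
  have h2 := norm_integral_sub_le (u n) f g
  rw [← dist_eq_norm, ← dist_eq_norm] at h1 h2
  rw [dist_comm] at h2
  have h3 := hM m hm n hn
  have h4 := dist_triangle4 (∫ x, f x ∂(u m : Measure X)) (∫ x, g x ∂(u m : Measure X))
    (∫ x, g x ∂(u n : Measure X)) (∫ x, f x ∂(u n : Measure X))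
  linarith

lemma tendsto_integral_of_tendsto [T2Space X] {ι : Type*} {l : Filter ι}
    {u : ι → ProbabilityMeasure X} {ν : ProbabilityMeasure X} (h : Tendsto u l (𝓝 ν))
    (f : C(X, ℂ)) :
    Tendsto (fun N => ∫ x, f x ∂(u N : Measure X)) l (𝓝 (∫ x, f x ∂(ν : Measure X))) :=
  (ProbabilityMeasure.tendsto_iff_forall_integral_rclike_tendsto ℂ).1 h
    (BoundedContinuousFunction.mkOfCompact f)

/-- Probability measures on a compact space converge weakly as soon as their integrals against a
point-separating, multiplicatively closed family of continuous functions do. -/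
lemma exists_tendsto_of_separating [T2Space X] (u : ℕ → ProbabilityMeasure X)
    (A : Submonoid C(X, ℂ)) (hstar : ∀ f ∈ A, star f ∈ A)
    (hsep : ∀ x y, x ≠ y → ∃ f ∈ A, f x ≠ f y)
    (hconv : ∀ f ∈ A, ∃ ℓ, Tendsto (fun N => ∫ x, f x ∂(u N : Measure X)) atTop (𝓝 ℓ)) :
    ∃ ν : ProbabilityMeasure X, Tendsto u atTop (𝓝 ν) := by
  have hcauchy : ∀ f : C(X, ℂ), CauchySeq fun N => ∫ x, f x ∂(u N : Measure X) := by
    let B := StarAlgebra.adjoin ℂ (A : Set C(X, ℂ))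
    have hB : B.topologicalClosure = ⊤ := by
      refine ContinuousMap.starSubalgebra_topologicalClosure_eq_top_of_separatesPoints B ?_
      intro x y hxy
      obtain ⟨f, hf, hne⟩ := hsep x y hxy
      exact ⟨f, ⟨f, StarAlgebra.subset_adjoin ℂ _ hf, rfl⟩, hne⟩
    let S : Submodule ℂ C(X, ℂ) :=
      { carrier := {f | ∃ ℓ, Tendsto (fun N => ∫ x, f x ∂(u N : Measure X)) atTop (𝓝 ℓ)}
        zero_mem' := ⟨0, by simp⟩
        add_mem' := by
          rintro f g ⟨a, ha⟩ ⟨b, hb⟩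
          refine ⟨a + b, (ha.add hb).congr fun N => ?_⟩
          exact (integral_add (integrable_continuousMap _ f) (integrable_continuousMap _ g)).symm
        smul_mem' := by
          rintro c f ⟨a, ha⟩
          refine ⟨c • a, (ha.const_smul c).congr fun N => ?_⟩
          exact (integral_smul c _).symm }
    -- As `A` is closed under products and conjugation, the star algebra it generates is its linear
    -- span, and convergence of integrals is linear.
    have hBS : (B : Set C(X, ℂ)) ⊆ S := by
      intro f hf
      have h1 : f ∈ Algebra.adjoin ℂ ((A : Set C(X, ℂ)) ∪ star (A : Set C(X, ℂ))) := by
        rw [← StarAlgebra.adjoin_toSubalgebra]; exact hf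
      have h2 : (A : Set C(X, ℂ)) ∪ star (A : Set C(X, ℂ)) = A := by
        refine Set.union_eq_left.2 fun g hg => ?_
        simpa using hstar _ hg
      rw [h2, ← Subalgebra.mem_toSubmodule, Algebra.adjoin_eq_span, Submonoid.closure_eq] at h1
      exact Submodule.span_le.2 (fun g hg => hconv g hg) h1
    intro f
    have hf : f ∈ closure (B : Set C(X, ℂ)) := by
      rw [← StarSubalgebra.topologicalClosure_coe, hB]; trivial
    refine closure_minimal (fun g hg => ?_) (isClosed_cauchySeq_integral u) hf
    obtain ⟨ℓ, hℓ⟩ := hBS hg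
    exact hℓ.cauchySeq
  -- Compactness of the space of probability measures supplies a cluster point; since every sequence
  -- of integrals converges, it is the limit.
  obtain ⟨ν, hν⟩ : ∃ ν, MapClusterPt ν atTop u := exists_clusterPt_of_compactSpace _
  refine ⟨ν, (ProbabilityMeasure.tendsto_iff_forall_integral_rclike_tendsto ℂ).2 fun f => ?_⟩
  obtain ⟨ℓ, hℓ⟩ := cauchySeq_tendsto_of_complete (hcauchy f.toContinuousMap)
  have hcl : MapClusterPt (∫ x, f x ∂(ν : Measure X)) atTop
      fun N => ∫ x, f x ∂(u N : Measure X) :=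
    hν.continuousAt_comp (tendsto_integral_of_tendsto tendsto_id f.toContinuousMap)
  have hne : (𝓝 (∫ x, f x ∂(ν : Measure X)) ⊓ 𝓝 ℓ).NeBot :=
    hcl.neBot.mono (inf_le_inf_left _ hℓ)
  rw [eq_of_nhds_neBot hne]
  exact hℓ

end WeakLimit

/-! ### Finite laws -/

lemma integral_map_normalize {α X E : Type*} [Fintype α] [MeasurableSpace X]
    [NormedAddCommGroup E] [NormedSpace ℝ E] [CompleteSpace E] {w : α → ℝ≥0∞} {v : α → ℝ}
    (hv : ∀ a, 0 ≤ v a)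
    (hw : ∀ a, w a = ENNReal.ofReal (v a)) (h0 : ∑' a, w a ≠ 0) (hT : ∑' a, w a ≠ ∞) (g : α → X)
    {F : X → E} (hF : StronglyMeasurable F) :
    ∫ x, F x ∂((PMF.normalize w h0 hT).map g).toMeasure =
      (∑ a, v a)⁻¹ • ∑ a, v a • F (g a) := by
  let _ : MeasurableSpace α := ⊤
  have hg : Measurable g := fun _ _ => trivial
  rw [← PMF.toMeasure_map _ _ hg, integral_map hg.aemeasurable hF.aestronglyMeasurable,
    PMF.integral_eq_sum, Finset.smul_sum]
  refine Finset.sum_congr rfl fun a _ => ?_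
  rw [PMF.normalize_apply, tsum_fintype, ENNReal.toReal_mul, ENNReal.toReal_inv, smul_smul, mul_comm]
  congr 2
  · simp only [hw, ← ENNReal.ofReal_sum_of_nonneg fun a _ => hv a]
    rw [ENNReal.toReal_ofReal (Finset.sum_nonneg fun a _ => hv a)]
  · rw [hw, ENNReal.toReal_ofReal (hv a)]

/-! ### Counting cocycles of a cube -/

lemma card_eq_card_map_mul {R V W : Type*} [Ring R] [AddCommGroup V] [AddCommGroup W] [Module R V]
    [Module R W] (φ : V →ₗ[R] W) (Y : Submodule R V) :
    Nat.card Y = Nat.card (Y ⊓ LinearMap.ker φ : Submodule R V) * Nat.card (Y.map φ) := by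
  rw [Submodule.card_eq_card_quotient_mul_card (LinearMap.ker (φ.domRestrict Y))]
  congr 1
  · refine Nat.card_congr ?_
    refine ⟨fun y => ⟨y.1.1, y.1.2, y.2⟩, fun y => ⟨⟨y.1, y.2.1⟩, y.2.2⟩, fun _ => rfl, fun _ => rfl⟩
  · rw [Nat.card_congr (φ.domRestrict Y).quotKerEquivRange.toEquiv, LinearMap.range_domRestrict]

/-- The difference map on `S × T` has image inside `Y` and kernel a copy of `S ⊓ T`. -/
lemma card_mul_card_le {R V : Type*} [Ring R] [AddCommGroup V] [Module R V] [Finite V]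
    {S T Y : Submodule R V} (hS : S ≤ Y) (hT : T ≤ Y) :
    Nat.card S * Nat.card T ≤ Nat.card Y * Nat.card (S ⊓ T : Submodule R V) := by
  let φ : V × V →ₗ[R] V := LinearMap.fst R V V - LinearMap.snd R V V
  have h := card_eq_card_map_mul φ (S.prod T)
  have h1 : Nat.card (S.prod T) = Nat.card S * Nat.card T := by
    rw [← Nat.card_prod]
    exact Nat.card_congr ⟨fun y => (⟨y.1.1, y.2.1⟩, ⟨y.1.2, y.2.2⟩),
      fun y => ⟨(y.1, y.2), y.1.2, y.2.2⟩, fun _ => rfl, fun _ => rfl⟩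
  rw [← h1, h, mul_comm]
  refine Nat.mul_le_mul ?_ ?_
  · refine Nat.card_mono (Set.toFinite _) ?_
    rintro _ ⟨y, hy, rfl⟩
    exact Y.sub_mem (hS hy.1) (hT hy.2)
  · refine Nat.card_le_card_of_injective
      (fun y => (⟨y.1.1, y.2.1.1, by
        have : y.1.1 - y.1.2 = 0 := y.2.2
        rw [sub_eq_zero.1 this]; exact y.2.1.2⟩ : (S ⊓ T : Submodule R V))) ?_
    intro y y' hyy
    have e : y.1.1 = y'.1.1 := congrArg Subtype.val hyy
    have h2 : y.1.1 - y.1.2 = 0 := y.2.2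
    have h3 : y'.1.1 - y'.1.2 = 0 := y'.2.2
    exact Subtype.ext (Prod.ext e (by rw [← sub_eq_zero.1 h2, ← sub_eq_zero.1 h3, e]))

/-- The restriction of a cochain to the cube `[-N, N]^d`. -/
def restrictBox (N : ℕ) : Cochain d k q →ₗ[ZMod q] BoxCochain d k q N :=
  LinearMap.funLeft (ZMod q) (ZMod q) Subtype.val

lemma restrictBox_apply (N : ℕ) (f : Cochain d k q) (σ : BoxCell d k N) :
    restrictBox N f σ = f σ.1 := rfl

lemma extendZero_apply (N : ℕ) (f : BoxCochain d k q N) (σ : BoxCell d k N) :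
    extendZero N f σ.1 = f σ :=
  Subtype.val_injective.extend_apply f 0 σ

lemma extendZero_restrictBox (N : ℕ) (f : Cochain d k q) {σ : Cell d k} (h : σ.InBox N) :
    extendZero N (restrictBox N f) σ = f σ :=
  extendZero_apply N (restrictBox N f) ⟨σ, h⟩

lemma boxCoboundary_apply (N : ℕ) (f : BoxCochain d k q N) (σ : BoxCell d (k + 1) N) :
    boxCoboundary N f σ = coboundary (extendZero N f) σ.1 := rfl

/-- The cocycles in the cube `[-N, N]^d` of the complex given by a configuration and a boundary
condition. -/
def localCocycles (q N : ℕ) (b : BC) (ω : Config d (k + 1)) :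
    Submodule (ZMod q) (BoxCochain d k q N) where
  carrier := {f | ∀ σ ∈ openPlaquettes N b ω, coboundary (extendZero N f) σ = 0}
  add_mem' hf hg σ hσ := by simp [hf σ hσ, hg σ hσ]
  zero_mem' σ _ := by simp
  smul_mem' a f hf σ hσ := by simp [hf σ hσ]

lemma toConfig_eq_true {N : ℕ} {P : Finset (IntCell d k N)} {σ : Cell d k} :
    toConfig N P σ = true ↔ ∃ τ ∈ P, τ.1 = σ := by
  simp [toConfig]

lemma toConfig_apply {N : ℕ} {P : Finset (IntCell d k N)} (τ : IntCell d k N) :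
    toConfig N P τ.1 = true ↔ τ ∈ P := by
  rw [toConfig_eq_true]
  exact ⟨fun ⟨τ', h, e⟩ => Subtype.ext e ▸ h, fun h => ⟨τ, h, rfl⟩⟩

lemma cocycles_withBoundary (N : ℕ) (b : BC) (P : Finset (IntCell d (k + 1) N)) :
    cocycles q N (withBoundary N P b) = localCocycles q N b (toConfig N P) := by
  ext f
  have h : ∀ σ : BoxCell d (k + 1) N, σ ∈ withBoundary N P b ↔
      σ.1 ∈ openPlaquettes N b (toConfig N P) := by
    intro σ
    have hi : (Inner N σ.1.1 σ.1.2.1 ∧ toConfig N P σ.1 = true) ↔ ∃ τ ∈ P, τ.1 = σ.1 := by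
      rw [toConfig_eq_true]
      refine and_iff_right_of_imp ?_
      rintro ⟨τ, -, h⟩
      rw [← h]
      exact (Cell.inner_iff _).2 τ.2
    cases b <;> simp [withBoundary, openPlaquettes, hi]
  constructor
  · intro hf σ hσ
    have hb : σ.InBox N := by
      rcases hσ with hσ | hσ
      · exact (σ.inner_iff.1 hσ.1).1
      · exact hσ.2.1
    exact hf ⟨σ, hb⟩ ((h ⟨σ, hb⟩).2 hσ)
  · intro hf σ hσ
    exact hf σ.1 ((h σ).1 hσ)

lemma coboundaries_le (N : ℕ) (A : Set (BoxCell d (k + 1) N)) :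
    coboundaries q N k ≤ cocycles q N A := by
  cases k with
  | zero =>
    refine Submodule.span_le.2 ?_
    rintro _ rfl σ -
    rw [boxCoboundary_apply, coboundary_congr_of_inBox (N := N) (g := fun _ => 1)
      (fun σ hσ => extendZero_apply N (fun _ => 1) ⟨σ, hσ⟩) σ.2, coboundary_one]
    rfl
  | succ k =>
    rintro _ ⟨g, rfl⟩ σ -
    rw [boxCoboundary_apply, coboundary_congr_of_inBox (N := N) (g := coboundary (extendZero N g))
      (fun σ hσ => extendZero_apply N (boxCoboundary N g) ⟨σ, hσ⟩) σ.2, coboundary_coboundary]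
    rfl

/-- The first factor does not depend on `A`, so in the random-cluster weights cohomology groups may
be replaced by cocycle groups. -/
lemma card_cocycles (N : ℕ) (A : Set (BoxCell d (k + 1) N)) :
    Nat.card (cocycles q N A) = Nat.card (coboundaries (d := d) q N k) *
      Nat.card (Cohomology q N A) := by
  rw [Submodule.card_eq_card_quotient_mul_card
    ((coboundaries q N k).submoduleOf (cocycles q N A)),
    Nat.card_congr (Submodule.submoduleOfEquivOfLe (coboundaries_le N A)).toEquiv]

lemma localCocycles_anti {N : ℕ} {b : BC} {ω ω' : Config d (k + 1)}
    (h : ∀ σ, ω σ = true → ω' σ = true) : localCocycles q N b ω' ≤ localCocycles q N b ω :=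
  fun _ hf σ hσ => hf σ (hσ.imp_left fun h' => ⟨h'.1, h σ h'.2⟩)

/-- The number of cocycles is log-supermodular. -/
lemma card_localCocycles_mul_le [NeZero q] {N : ℕ} (b : BC) (P Q : Finset (IntCell d (k + 1) N))
    [DecidableEq (IntCell d (k + 1) N)] :
    Nat.card (localCocycles q N b (toConfig N P)) * Nat.card (localCocycles q N b (toConfig N Q)) ≤
      Nat.card (localCocycles q N b (toConfig N (P ∩ Q))) *
        Nat.card (localCocycles q N b (toConfig N (P ∪ Q))) := by
  have hsup : localCocycles q N b (toConfig N (P ∪ Q)) =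
      localCocycles q N b (toConfig N P) ⊓ localCocycles q N b (toConfig N Q) := by
    refine le_antisymm (le_inf ?_ ?_) fun f hf σ hσ => ?_
    · refine localCocycles_anti fun σ h => ?_
      rw [toConfig_eq_true] at h ⊢
      exact h.imp fun τ h => ⟨Finset.mem_union_left _ h.1, h.2⟩
    · refine localCocycles_anti fun σ h => ?_
      rw [toConfig_eq_true] at h ⊢
      exact h.imp fun τ h => ⟨Finset.mem_union_right _ h.1, h.2⟩
    · rcases hσ with ⟨hi, hσ⟩ | hσ
      · obtain ⟨τ, hτ, e⟩ := toConfig_eq_true.1 hσ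
        rcases Finset.mem_union.1 hτ with hτ | hτ
        · exact hf.1 σ (Or.inl ⟨hi, toConfig_eq_true.2 ⟨τ, hτ, e⟩⟩)
        · exact hf.2 σ (Or.inl ⟨hi, toConfig_eq_true.2 ⟨τ, hτ, e⟩⟩)
      · exact hf.1 σ (Or.inr hσ)
  rw [hsup]
  refine card_mul_card_le (localCocycles_anti fun σ h => ?_) (localCocycles_anti fun σ h => ?_)
  · rw [toConfig_eq_true] at h ⊢
    exact h.imp fun τ h => ⟨Finset.mem_of_mem_inter_left h.1, h.2⟩
  · rw [toConfig_eq_true] at h ⊢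
    exact h.imp fun τ h => ⟨Finset.mem_of_mem_inter_right h.1, h.2⟩

/-! ### Plaquette sets of a smaller cube -/

/-- The inclusion of the interior cells of a cube into those of a larger one. -/
def innerEmb {n N : ℕ} (h : n ≤ N) : IntCell d k n ↪ IntCell d k N where
  toFun σ := ⟨σ.1, σ.1.inner_iff.1 ((σ.1.inner_iff.2 σ.2).mono h)⟩
  inj' _ _ e := Subtype.ext (congrArg (fun x : IntCell d k N => x.1) e)

open Classical in
/-- The plaquettes outside the smaller cube that the boundary condition on it amounts to. -/
def outer (n N : ℕ) : BC → Finset (IntCell d k N)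
  | .free => ∅
  | .wired => Finset.univ.filter fun τ => ¬ Inner n τ.1.1 τ.1.2.1

lemma mem_outer {n N : ℕ} {b : BC} {τ : IntCell d k N} :
    τ ∈ outer n N b ↔ b = .wired ∧ ¬ Inner n τ.1.1 τ.1.2.1 := by
  cases b <;> simp [outer]

lemma disjoint_outer {n N : ℕ} (h : n ≤ N) (b : BC) (P : Finset (IntCell d k n)) :
    Disjoint (P.map (innerEmb h)) (outer n N b) := by
  rw [Finset.disjoint_left]
  intro τ hτ hτ'
  obtain ⟨σ, -, rfl⟩ := Finset.mem_map.1 hτ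
  exact (mem_outer.1 hτ').2 (σ.1.inner_iff.2 σ.2)

/-- The plaquette set in a cube that corresponds to one in a smaller cube with boundary
condition. -/
def enlarge {n N : ℕ} (h : n ≤ N) (b : BC) (P : Finset (IntCell d k n)) : Finset (IntCell d k N) :=
  (P.map (innerEmb h)).disjUnion (outer n N b) (disjoint_outer h b P)

lemma card_enlarge {n N : ℕ} (h : n ≤ N) (b : BC) (P : Finset (IntCell d k n)) :
    (enlarge h b P).card = P.card + (outer (d := d) (k := k) n N b).card := by
  rw [enlarge, Finset.card_disjUnion, Finset.card_map]

lemma mem_enlarge_of_inner {n N : ℕ} (h : n ≤ N) (b : BC) {P : Finset (IntCell d k n)}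
    {τ : IntCell d k N} (hi : Inner n τ.1.1 τ.1.2.1) :
    τ ∈ enlarge h b P ↔ ⟨τ.1, τ.1.inner_iff.1 hi⟩ ∈ P := by
  rw [enlarge, Finset.mem_disjUnion, Finset.mem_map]
  constructor
  · rintro (⟨σ, hσ, rfl⟩ | hτ)
    · exact hσ
    · exact absurd hi (mem_outer.1 hτ).2
  · exact fun hP => Or.inl ⟨_, hP, rfl⟩

lemma mem_enlarge_of_not_inner {n N : ℕ} (h : n ≤ N) (b : BC) {P : Finset (IntCell d k n)}
    {τ : IntCell d k N} (hi : ¬ Inner n τ.1.1 τ.1.2.1) :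
    τ ∈ enlarge h b P ↔ b = .wired := by
  rw [enlarge, Finset.mem_disjUnion, Finset.mem_map]
  constructor
  · rintro (⟨σ, hσ, rfl⟩ | hτ)
    · exact absurd (σ.1.inner_iff.2 σ.2) hi
    · exact (mem_outer.1 hτ).1
  · exact fun hb => Or.inr (mem_outer.2 ⟨hb, hi⟩)

lemma enlarge_injective {n N : ℕ} (h : n ≤ N) (b : BC) :
    Function.Injective (enlarge (d := d) (k := k) h b) := by
  intro P Q e
  ext σ
  have hi := σ.1.inner_iff.2 σ.2
  have := Finset.ext_iff.1 e (innerEmb h σ)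
  rwa [mem_enlarge_of_inner h b (τ := innerEmb h σ) hi,
    mem_enlarge_of_inner h b (τ := innerEmb h σ) hi] at this

lemma mem_range_enlarge {n N : ℕ} (h : n ≤ N) (b : BC) {a : Finset (IntCell d k N)}
    (ha : ∀ τ : IntCell d k N, ¬ Inner n τ.1.1 τ.1.2.1 → (τ ∈ a ↔ b = .wired)) :
    ∃ P, enlarge h b P = a := by
  classical
  refine ⟨Finset.univ.filter fun σ => innerEmb h σ ∈ a, ?_⟩
  ext τ
  by_cases hi : Inner n τ.1.1 τ.1.2.1
  · rw [mem_enlarge_of_inner h b hi]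
    exact Finset.mem_filter.trans (and_iff_right (Finset.mem_univ _))
  · rw [mem_enlarge_of_not_inner h b hi, ha τ hi]

lemma toConfig_enlarge {n N : ℕ} (h : n ≤ N) (b : BC) {P : Finset (IntCell d k n)} {σ : Cell d k}
    (hi : Inner n σ.1 σ.2.1) : toConfig N (enlarge h b P) σ = toConfig n P σ := by
  rw [Bool.eq_iff_iff]
  exact (toConfig_apply ⟨σ, σ.inner_iff.1 (hi.mono h)⟩).trans
    ((mem_enlarge_of_inner h b hi).trans (toConfig_apply ⟨σ, σ.inner_iff.1 hi⟩).symm)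

/-- The cocycles of the smaller cube with boundary condition are the restrictions of those of the
larger cube. -/
lemma map_localCocycles_enlarge {n N : ℕ} (h : n ≤ N) (b : BC) (P : Finset (IntCell d (k + 1) n)) :
    (localCocycles q N b (toConfig N (enlarge h b P))).map (restrictBox n ∘ₗ extendZero N) =
      localCocycles q n b (toConfig n P) := by
  have hcob : ∀ (f : BoxCochain d k q N) {σ : Cell d (k + 1)}, σ.InBox n →
      coboundary (extendZero n (restrictBox n (extendZero N f))) σ =
        coboundary (extendZero N f) σ := fun f σ hσ =>
    coboundary_congr_of_inBox (fun σ hσ => extendZero_restrictBox n _ hσ) hσ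
  ext g
  constructor
  · rintro ⟨f, hf, rfl⟩ σ hσ
    rw [LinearMap.comp_apply]
    rcases hσ with ⟨hi, hσ⟩ | ⟨hb, hσ⟩
    · rw [hcob f (σ.inner_iff.1 hi).1]
      exact hf σ (Or.inl ⟨hi.mono h, by rw [toConfig_enlarge h b hi, hσ]⟩)
    · rw [hcob f hσ.1]
      refine hf σ ?_
      -- A boundary plaquette of the small cube is either interior to the large one, hence outer and
      -- open, or in the large boundary too.
      by_cases hi : Inner N σ.1 σ.2.1
      · refine Or.inl ⟨hi, (toConfig_apply ⟨σ, σ.inner_iff.1 hi⟩).2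
          ((mem_enlarge_of_not_inner h b fun hn => ?_).2 hb)⟩
        exact (σ.inner_iff.1 hn).2 hσ
      · refine Or.inr ⟨hb, ?_⟩
        by_contra hn
        exact hi (σ.inner_iff.2 ⟨hσ.1.mono h, hn⟩)
  · intro hg
    -- The retraction provides the extension of `g`. Outside the small cube it is closed everywhere
    -- in the wired case, and no condition is imposed there in the free case.
    refine ⟨restrictBox N (retractCochain n (extendZero n g)), fun σ hσ => ?_, ?_⟩
    · have hbox : σ.InBox N := by
        rcases hσ with hσ | hσ
        · exact (σ.inner_iff.1 hσ.1).1
        · exact hσ.2.1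
      rw [coboundary_congr_of_inBox (fun σ hσ => extendZero_restrictBox N _ hσ) hbox]
      have hopen : Inner n σ.1 σ.2.1 → toConfig n P σ = true := by
        intro hi
        rw [← toConfig_enlarge h b hi]
        rcases hσ with hσ | hσ
        · exact hσ.2
        · exact absurd hσ.2 (σ.inner_iff.1 (hi.mono h)).2
      by_cases hi : Inner n σ.1 σ.2.1
      · rw [coboundary_retractCochain, retractCochain_apply_of_inBox _ (σ.inner_iff.1 hi).1]
        exact hg σ (Or.inl ⟨hi, hopen hi⟩)
      · cases b with
        | wired => exact coboundary_retractCochain_eq_zero hg hopen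
        | free =>
          rcases hσ with hσ | hσ
          · have := (toConfig_apply ⟨σ, σ.inner_iff.1 hσ.1⟩).1 hσ.2
            rw [mem_enlarge_of_not_inner h _ hi] at this
            exact absurd this (by simp)
          · exact absurd hσ.1 (by simp)
    · funext σ
      rw [LinearMap.comp_apply, restrictBox_apply, extendZero_restrictBox N _ (σ.2.mono h),
        retractCochain_apply_of_inBox _ σ.2, extendZero_apply]

/-- `C` is the size of the kernel of the restriction to the small cube. Cochains in this kernel
vanish there, so the plaquettes of `P` impose no condition on them and the kernel is the same for
all `P`. -/
lemma exists_card_localCocycles_enlarge [NeZero q] {n N : ℕ} (h : n ≤ N) (b : BC) :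
    ∃ C : ℕ, 0 < C ∧ ∀ P : Finset (IntCell d (k + 1) n),
      Nat.card (localCocycles q N b (toConfig N (enlarge h b P))) =
        C * Nat.card (localCocycles q n b (toConfig n P)) := by
  let R : BoxCochain d k q N →ₗ[ZMod q] BoxCochain d k q n := restrictBox n ∘ₗ extendZero N
  refine ⟨Nat.card (localCocycles q N b (toConfig N (enlarge h b (∅ : Finset (IntCell d (k + 1) n))))
    ⊓ LinearMap.ker R : Submodule (ZMod q) (BoxCochain d k q N)), Nat.card_pos, fun P => ?_⟩
  rw [card_eq_card_map_mul R, map_localCocycles_enlarge]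
  congr 2
  have key : ∀ P Q : Finset (IntCell d (k + 1) n),
      localCocycles q N b (toConfig N (enlarge h b P)) ⊓ LinearMap.ker R ≤
        localCocycles q N b (toConfig N (enlarge h b Q)) ⊓ LinearMap.ker R := by
    refine fun P Q f hf => ⟨fun σ hσ => ?_, hf.2⟩
    rcases hσ with ⟨hi, hσ⟩ | hσ
    · by_cases hn : Inner n σ.1 σ.2.1
      · rw [coboundary_congr_of_inBox (N := n) (g := 0) (fun τ hτ => ?_) (σ.inner_iff.1 hn).1,
          map_zero, Pi.zero_apply]
        exact congrFun (LinearMap.mem_ker.1 hf.2) ⟨τ, hτ⟩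
      · refine hf.1 σ (Or.inl ⟨hi, ?_⟩)
        have h1 := (toConfig_apply ⟨σ, σ.inner_iff.1 hi⟩).1 hσ
        rw [mem_enlarge_of_not_inner h b hn] at h1
        exact (toConfig_apply ⟨σ, σ.inner_iff.1 hi⟩).2 ((mem_enlarge_of_not_inner h b hn).2 h1)
    · exact hf.1 σ (Or.inr hσ)
  rw [le_antisymm (key P ∅) (key ∅ P)]

/-! ### The finite volume measures -/

/-- The unnormalized weight of a plaquette set, up to a constant. -/
def weight (q N : ℕ) (b : BC) (p : ℝ) (P : Finset (IntCell d (k + 1) N)) : ℝ :=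
  p ^ P.card * (1 - p) ^ (Fintype.card (IntCell d (k + 1) N) - P.card) *
    Nat.card (localCocycles q N b (toConfig N P))

open Classical in
/-- The probability of an event in the plaquette random-cluster model on a cube. -/
def prob (q N : ℕ) (b : BC) (p : ℝ) (A : Set (Config d (k + 1))) : ℝ :=
  (∑ P : Finset (IntCell d (k + 1) N), if toConfig N P ∈ A then weight q N b p P else 0) /
    ∑ P : Finset (IntCell d (k + 1) N), weight q N b p P

lemma card_localCocycles_pos [NeZero q] (N : ℕ) (b : BC) (ω : Config d (k + 1)) :
    (0 : ℝ) < Nat.card (localCocycles q N b ω) :=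
  Nat.cast_pos.2 Nat.card_pos

lemma weight_nonneg (q N : ℕ) (b : BC) {p : ℝ} (h0 : 0 ≤ p) (h1 : p ≤ 1)
    (P : Finset (IntCell d (k + 1) N)) : 0 ≤ weight q N b p P := by
  have : 0 ≤ 1 - p := by linarith
  unfold weight; positivity

lemma pow_card_mul_sum_pos {α : Type*} [Fintype α] {p : ℝ} (h0 : 0 ≤ p) (h1 : p < 1)
    {z : Finset α → ℝ} (hz : ∀ a, 0 < z a) :
    0 < ∑ a : Finset α, p ^ a.card * (1 - p) ^ (Fintype.card α - a.card) * z a := by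
  have h1' : 0 < 1 - p := by linarith
  refine Finset.sum_pos' (fun a _ => ?_) ⟨∅, Finset.mem_univ _, ?_⟩
  · have := hz a
    positivity
  · have := hz ∅
    simp only [Finset.card_empty, pow_zero, one_mul]
    positivity

lemma sum_weight_pos [NeZero q] (N : ℕ) (b : BC) {p : ℝ} (h0 : 0 ≤ p) (h1 : p < 1) :
    0 < ∑ P : Finset (IntCell d (k + 1) N), weight q N b p P :=
  pow_card_mul_sum_pos h0 h1 fun P => card_localCocycles_pos N b (toConfig N P)

lemma prcm_real_eq_prob [NeZero q] (N : ℕ) (b : BC) (p : unitInterval)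
    {A : Set (Config d (k + 1))} (hA : MeasurableSet A) :
    (prcm d k q b p N : Measure (Config d (k + 1))).real A = prob q N b p A := by
  classical
  let v : Finset (IntCell d (k + 1) N) → ℝ := fun P =>
    (p : ℝ) ^ P.card * (1 - (p : ℝ)) ^ (Fintype.card (IntCell d (k + 1) N) - P.card)
      * Nat.card (Cohomology q N (withBoundary N P b))
  have hv : ∀ P, 0 ≤ v P := fun P => by
    have h0 := p.2.1
    have h1 : 0 ≤ 1 - (p : ℝ) := by linarith [p.2.2]
    positivity
  have hB : (0 : ℝ) < Nat.card (coboundaries (d := d) q N k) := Nat.cast_pos.2 Nat.card_pos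
  have hw : ∀ P, weight q N b p P = Nat.card (coboundaries (d := d) q N k) * v P := by
    intro P
    rw [weight, ← cocycles_withBoundary, card_cocycles]
    push_cast
    ring
  have hint := integral_map_normalize (X := Config d (k + 1)) hv (fun P => rfl)
    (prcmWeight_tsum_ne_zero (q := q) N b p) (prcmWeight_tsum_ne_top N b p) (toConfig N)
    (F := A.indicator (1 : Config d (k + 1) → ℝ)) (stronglyMeasurable_one.indicator hA)
  rw [integral_indicator_one hA] at hint
  refine hint.trans ?_
  simp only [prob, hw, ← Finset.mul_sum, ← mul_ite_zero]
  rw [mul_div_mul_left _ _ hB.ne', smul_eq_mul, inv_mul_eq_div]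
  simp [Set.indicator_apply]

/-! ### The coupling of the two models -/

lemma continuous_evalChain (γ : Chain d k q) :
    Continuous fun f : Cochain d k q => evalChain f γ :=
  continuous_finsetSum _ fun σ _ => continuous_const.mul (continuous_apply σ)

lemma continuous_wilson [NeZero q] (γ : Chain d k q) : Continuous (wilson γ) :=
  continuous_of_discreteTopology.comp (continuous_evalChain γ)

lemma mem_localCocycles_toConfig {N : ℕ} {b : BC} {P : Finset (IntCell d (k + 1) N)}
    {f : BoxCochain d k q N} : f ∈ localCocycles q N b (toConfig N P) ↔
      f ∈ admissible N b ∧ ∀ σ ∈ P, boxCoboundary N f ⟨σ.1, σ.2.1⟩ = 0 := by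
  constructor
  · refine fun h => ⟨?_, fun σ hσ =>
      h σ.1 (Or.inl ⟨σ.1.inner_iff.2 σ.2, (toConfig_apply σ).2 hσ⟩)⟩
    cases b with
    | free => trivial
    | wired => exact fun σ hσ => h σ.1 (Or.inr ⟨rfl, hσ⟩)
  · rintro ⟨h1, h2⟩ σ (⟨hi, hσ⟩ | ⟨rfl, hσ⟩)
    · obtain ⟨τ, hτ, rfl⟩ := toConfig_eq_true.1 hσ
      exact h2 τ hτ
    · exact h1 ⟨σ, hσ.1⟩ hσ

-- The Edwards–Sokal expansion: a product of two-term factors over plaquettes becomes a sum over the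
-- sets `P` where the term `p` is chosen, and this term survives only where the coboundary vanishes.
open Classical in
lemma gibbsWeight_eq (N : ℕ) (b : BC) {β p : ℝ} (hp : p = 1 - Real.exp (-β))
    (f : BoxCochain d k q N) :
    (if f ∈ admissible N b then Real.exp (-β * hamiltonian N f) else 0) =
      Real.exp β ^ Fintype.card (IntCell d (k + 1) N) *
        ∑ P : Finset (IntCell d (k + 1) N),
          p ^ P.card * (1 - p) ^ (Fintype.card (IntCell d (k + 1) N) - P.card) *
            if f ∈ localCocycles q N b (toConfig N P) then 1 else 0 := by
  by_cases hf : f ∈ admissible N b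
  · have h1 : ∀ σ : IntCell d (k + 1) N,
        Real.exp (β * if boxCoboundary N f ⟨σ.1, σ.2.1⟩ = 0 then (1 : ℝ) else 0) =
          Real.exp β * ((if boxCoboundary N f ⟨σ.1, σ.2.1⟩ = 0 then p else 0) + (1 - p)) := by
      intro σ
      have e : Real.exp β * Real.exp (-β) = 1 := by rw [← Real.exp_add]; simp
      split_ifs
      · simp
      · rw [mul_zero, Real.exp_zero, hp]; linarith
    rw [if_pos hf, hamiltonian, neg_mul_neg, Finset.mul_sum, Real.exp_sum]
    simp only [h1]
    rw [Finset.prod_mul_distrib, Finset.prod_const, Finset.card_univ, Finset.prod_add,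
      Finset.powerset_univ]
    congr 1
    refine Finset.sum_congr rfl fun P _ => ?_
    rw [Finset.prod_const, Finset.card_sdiff_of_subset (Finset.subset_univ P), Finset.card_univ]
    by_cases hP : ∀ σ ∈ P, boxCoboundary N f ⟨σ.1, σ.2.1⟩ = 0
    · rw [if_pos (mem_localCocycles_toConfig.2 ⟨hf, hP⟩), mul_one,
        Finset.prod_congr rfl fun σ hσ => if_pos (hP σ hσ), Finset.prod_const]
    · rw [if_neg fun h => hP (mem_localCocycles_toConfig.1 h).2, mul_zero]
      push Not at hP
      obtain ⟨σ, hσ, hne⟩ := hP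
      rw [Finset.prod_eq_zero hσ (if_neg hne), zero_mul]
  · rw [if_neg hf, Finset.sum_eq_zero, mul_zero]
    intro P _
    rw [if_neg fun h => hf (mem_localCocycles_toConfig.1 h).1, mul_zero]

lemma mem_localV_iff {N : ℕ} {b : BC} {ω : Config d (k + 1)} {γ : Chain d k q}
    (hγ : ∀ σ ∈ γ.support, σ.InBox N) :
    ω ∈ localV b N γ ↔ ∀ f ∈ localCocycles q N b ω, evalChain (extendZero N f) γ = 0 := by
  constructor
  · exact fun h f hf => h _ hf
  · intro h f hf
    rw [← h (restrictBox N f) fun σ hσ => ?_]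
    · exact evalChain_congr fun σ hσ => (extendZero_restrictBox N f (hγ σ hσ)).symm
    · have hb : σ.InBox N := by
        rcases hσ with hσ | hσ
        · exact (σ.inner_iff.1 hσ.1).1
        · exact hσ.2.1
      rw [coboundary_congr_of_inBox (fun σ hσ => extendZero_restrictBox N f hσ) hb]
      exact hf σ hσ

-- Orthogonality of characters on the finite group of cocycles. The character is trivial exactly
-- when every cocycle vanishes on `γ`, because `ZMod.stdAddChar` is injective.
open Classical in
lemma sum_wilson_localCocycles [NeZero q] {N : ℕ} {b : BC} {ω : Config d (k + 1)}
    {γ : Chain d k q} (hγ : ∀ σ ∈ γ.support, σ.InBox N) :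
    ∑ f : BoxCochain d k q N,
      (if f ∈ localCocycles q N b ω then wilson γ (extendZero N f) else 0) =
      if ω ∈ localV b N γ then (Nat.card (localCocycles q N b ω) : ℂ) else 0 := by
  let ψ : AddChar (localCocycles q N b ω) ℂ :=
    { toFun f := wilson γ (extendZero N f)
      map_zero_eq_one' := by simp [wilson, evalChain_eq_zero]
      map_add_eq_mul' f g := by
        simp [wilson, evalChain_add_left, AddChar.map_add_eq_mul] }
  have hψ : ψ = 0 ↔ ω ∈ localV b N γ := by
    rw [mem_localV_iff hγ, AddChar.eq_zero_iff]
    constructor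
    · intro h f hf
      refine ZMod.injective_stdAddChar ?_
      rw [AddChar.map_zero_eq_one]
      exact h ⟨f, hf⟩
    · intro h f
      change ZMod.stdAddChar _ = 1
      rw [h f.1 f.2, AddChar.map_zero_eq_one]
  have h := AddChar.sum_eq_ite ψ
  rw [← Finset.sum_filter, Finset.sum_subtype (p := fun f => f ∈ localCocycles q N b ω) _
    (fun f => by simp)]
  refine h.trans ?_
  rw [Nat.card_eq_fintype_card]
  exact if_congr hψ rfl rfl

lemma integral_wilson_eq_prob [NeZero q] {N : ℕ} (b : BC) {β : ℝ} {p : ℝ}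
    (hp : p = 1 - Real.exp (-β)) {γ : Chain d k q}
    (hγ : ∀ σ ∈ γ.support, σ.InBox N) :
    ∫ f, wilson γ f ∂(plgt d k q b β N : Measure (Cochain d k q)) =
      (prob q N b p (localV b N γ) : ℂ) := by
  classical
  have hsum : ∀ η : Chain d k q, (∀ σ ∈ η.support, σ.InBox N) →
      ∑ f : BoxCochain d k q N,
        (if f ∈ admissible N b then Real.exp (-β * hamiltonian N f) else 0 : ℝ) •
          wilson η (extendZero N f) =
      (Real.exp β ^ Fintype.card (IntCell d (k + 1) N) : ℝ) *
        ((∑ P : Finset (IntCell d (k + 1) N),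
          if toConfig N P ∈ localV b N η then weight q N b p P else 0 : ℝ) : ℂ) := by
    intro η hη
    simp only [gibbsWeight_eq N b hp, mul_smul, Complex.real_smul]
    rw [← Finset.mul_sum]
    congr 1
    push_cast
    simp only [Finset.sum_mul]
    rw [Finset.sum_comm]
    refine Finset.sum_congr rfl fun P _ => ?_
    have hW := sum_wilson_localCocycles (b := b) (ω := toConfig N P) hη
    have hterm : ∀ c : ℂ, ∑ f : BoxCochain d k q N,
        c * ((if f ∈ localCocycles q N b (toConfig N P) then 1 else 0 : ℝ) : ℂ) *
          wilson η (extendZero N f) =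
        c * if toConfig N P ∈ localV b N η then
          (Nat.card (localCocycles q N b (toConfig N P)) : ℂ) else 0 := by
      intro c
      rw [← hW, Finset.mul_sum]
      refine Finset.sum_congr rfl fun f _ => ?_
      split_ifs <;> simp
    refine (hterm _).trans ?_
    split_ifs <;> simp [weight]
  have hE : (0 : ℝ) < Real.exp β ^ Fintype.card (IntCell d (k + 1) N) := by positivity
  -- For the zero chain the same identity computes the partition function, so the common factor
  -- cancels.
  have h0 := hsum 0 (by simp)
  have hV0 : ∀ ω : Config d (k + 1), ω ∈ localV b N (0 : Chain d k q) := fun ω f _ => by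
    simp [evalChain]
  simp only [wilson, show ∀ f : Cochain d k q, evalChain f 0 = 0 from fun f => by simp [evalChain],
    AddChar.map_zero_eq_one, hV0, if_true, Complex.real_smul, mul_one] at h0
  have hv : ∀ f : BoxCochain d k q N,
      (0 : ℝ) ≤ if f ∈ admissible N b then Real.exp (-β * hamiltonian N f) else 0 := by
    intro f; split_ifs <;> positivity
  have hint := integral_map_normalize (X := Cochain d k q) hv
    (w := plgtWeight N b β) (fun f => by unfold plgtWeight; split_ifs <;> simp)
    (plgtWeight_tsum_ne_zero N b β) (plgtWeight_tsum_ne_top N b β) (extendZero N)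
    (continuous_wilson γ).stronglyMeasurable
  refine hint.trans ?_
  rw [hsum γ hγ, Complex.real_smul, Complex.ofReal_inv, Complex.ofReal_sum, h0, prob,
    Complex.ofReal_div, inv_mul_eq_div]
  exact mul_div_mul_left _ _ (Complex.ofReal_ne_zero.2 hE.ne')

/-! ### Stochastic monotonicity in the volume -/

lemma holley_ratio {α : Type*} [Fintype α] [DecidableEq α] {f g μ : Finset α → ℝ}
    (hf : 0 ≤ f) (hg : 0 ≤ g) (hμ₀ : 0 ≤ μ) (hμ : Monotone μ) (hf' : 0 < ∑ a, f a)
    (hg' : 0 < ∑ a, g a) (h : ∀ a b, f a * g b ≤ f (a ∩ b) * g (a ∪ b)) :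
    (∑ a, μ a * f a) / ∑ a, f a ≤ (∑ a, μ a * g a) / ∑ a, g a := by
  have := holley (μ := μ) (f := fun a => f a / ∑ a, f a) (g := fun a => g a / ∑ a, g a) hμ₀
    (fun a => div_nonneg (hf a) hf'.le) (fun a => div_nonneg (hg a) hg'.le) hμ
    (by simp only [← Finset.sum_div]; rw [div_self hf'.ne', div_self hg'.ne'])
    (fun a b => by
      rw [div_mul_div_comm, div_mul_div_comm]
      exact div_le_div_of_nonneg_right (h a b) (mul_pos hf' hg').le)
  simpa only [← mul_div_assoc, ← Finset.sum_div] using this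

lemma mul_pow_le {x y A B C D : ℝ} {i i' j j' s s' t t' : ℕ} (hx : 0 ≤ x) (hy : 0 ≤ y)
    (hi : i + i' = s + s') (hj : j + j' = t + t') (h : A * B ≤ C * D) :
    x ^ i * y ^ j * A * (x ^ i' * y ^ j' * B) ≤ x ^ s * y ^ t * C * (x ^ s' * y ^ t' * D) := by
  have e1 : x ^ i * y ^ j * A * (x ^ i' * y ^ j' * B) = x ^ (i + i') * y ^ (j + j') * (A * B) := by
    ring
  have e2 : x ^ s * y ^ t * C * (x ^ s' * y ^ t' * D) = x ^ (s + s') * y ^ (t + t') * (C * D) := by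
    ring
  rw [e1, e2, hi, hj]
  exact mul_le_mul_of_nonneg_left h (by positivity)

open Classical in
/-- The weights of the smaller cube with boundary condition, as weights on the plaquette sets of the
larger cube. -/
def embWeight (q n N : ℕ) (b : BC) (p : ℝ) (a : Finset (IntCell d (k + 1) N)) : ℝ :=
  if ∀ τ : IntCell d (k + 1) N, ¬ Inner n τ.1.1 τ.1.2.1 → (τ ∈ a ↔ b = .wired) then
    -- Outer plaquettes receive no factor `p` or `1 - p`, so the total weight stays positive even if
    -- `p = 0` and all of them are open.
    p ^ (a.card - (outer (d := d) (k := k + 1) n N b).card) *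
      (1 - p) ^ (Fintype.card (IntCell d (k + 1) n) + (outer (d := d) (k := k + 1) n N b).card
        - a.card) * Nat.card (localCocycles q N b (toConfig N a))
  else 0

lemma embWeight_nonneg (q n N : ℕ) (b : BC) {p : ℝ} (h0 : 0 ≤ p) (h1 : p ≤ 1)
    (a : Finset (IntCell d (k + 1) N)) : 0 ≤ embWeight q n N b p a := by
  have : 0 ≤ 1 - p := by linarith
  unfold embWeight
  split_ifs <;> positivity

lemma exists_sum_embWeight [NeZero q] {n N : ℕ} (h : n ≤ N) (b : BC) (p : ℝ) :
    ∃ C : ℝ, 0 < C ∧ ∀ φ : Finset (IntCell d (k + 1) N) → ℝ,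
      ∑ a, φ a * embWeight q n N b p a = C * ∑ P, φ (enlarge h b P) * weight q n b p P := by
  obtain ⟨C, hC, hcard⟩ := exists_card_localCocycles_enlarge (d := d) (k := k) (q := q) h b
  refine ⟨C, Nat.cast_pos.2 hC, fun φ => ?_⟩
  rw [Finset.mul_sum]
  refine (Finset.sum_of_injOn (enlarge h b) (enlarge_injective h b).injOn (by simp) ?_ ?_).symm
  · intro a _ ha
    rw [embWeight, if_neg, mul_zero]
    intro hcond
    obtain ⟨P, rfl⟩ := mem_range_enlarge h b hcond
    exact ha ⟨P, by simp, rfl⟩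
  · intro P _
    rw [embWeight, if_pos fun τ hτ => mem_enlarge_of_not_inner h b hτ, hcard, weight, card_enlarge,
      Nat.add_sub_cancel, Nat.add_sub_add_right]
    push_cast
    ring

lemma toConfig_mono {N : ℕ} {P Q : Finset (IntCell d k N)} (h : P ⊆ Q) :
    toConfig N P ≤ toConfig N Q := by
  intro σ
  rw [Bool.le_iff_imp]
  simp only [toConfig_eq_true]
  exact fun ⟨τ, hτ, e⟩ => ⟨τ, h hτ, e⟩

/-- The event depends only on the plaquettes in the interior of the cube `[-n, n]^d`. -/
def LocalEvent (n : ℕ) (A : Set (Config d k)) : Prop :=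
  ∀ ω ω' : Config d k, (∀ σ : Cell d k, Inner n σ.1 σ.2.1 → ω σ = ω' σ) → (ω ∈ A ↔ ω' ∈ A)

lemma LocalEvent.mono {n N : ℕ} (h : n ≤ N) {A : Set (Config d k)} (hA : LocalEvent n A) :
    LocalEvent N A :=
  fun ω ω' hω => hA ω ω' fun σ hσ => hω σ (hσ.mono h)

lemma prob_eq_embWeight [NeZero q] {n N : ℕ} (h : n ≤ N) (b : BC) {p : ℝ} (h0 : 0 ≤ p) (h1 : p < 1)
    {A : Set (Config d (k + 1))} (hA : LocalEvent n A) [DecidablePred (· ∈ A)] :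
    0 < ∑ a, embWeight (d := d) (k := k) q n N b p a ∧
    prob q n b p A = (∑ a, (if toConfig N a ∈ A then 1 else 0) * embWeight q n N b p a) /
      ∑ a, embWeight (d := d) (k := k) q n N b p a := by
  obtain ⟨C, hC, hsum⟩ := exists_sum_embWeight (d := d) (k := k) (q := q) h b p
  have hs := hsum fun _ => 1
  simp only [one_mul] at hs
  rw [hsum, hs, mul_div_mul_left _ _ hC.ne']
  refine ⟨mul_pos hC (sum_weight_pos n b h0 h1), ?_⟩
  rw [prob]
  congr 1
  refine Finset.sum_congr rfl fun P _ => ?_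
  have hiff := hA (toConfig n P) (toConfig N (enlarge h b P))
    fun σ hσ => (toConfig_enlarge h b hσ).symm
  by_cases hP : toConfig n P ∈ A
  · rw [if_pos hP, if_pos (hiff.1 hP), one_mul]
  · rw [if_neg hP, if_neg fun h' => hP (hiff.2 h'), zero_mul]

lemma prob_eq_sum (q N : ℕ) (b : BC) (p : ℝ) (A : Set (Config d (k + 1))) [DecidablePred (· ∈ A)] :
    prob q N b p A = (∑ a, (if toConfig N a ∈ A then 1 else 0) * weight q N b p a) /
      ∑ a, weight (d := d) (k := k) q N b p a := by
  simp only [prob, ite_mul, one_mul, zero_mul]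
  congr!

lemma card_cast_mul_le [NeZero q] {N : ℕ} (b : BC) (P Q : Finset (IntCell d (k + 1) N))
    [DecidableEq (IntCell d (k + 1) N)] :
    (Nat.card (localCocycles q N b (toConfig N P)) : ℝ) *
        Nat.card (localCocycles q N b (toConfig N Q)) ≤
      Nat.card (localCocycles q N b (toConfig N (P ∩ Q))) *
        Nat.card (localCocycles q N b (toConfig N (P ∪ Q))) := by
  exact_mod_cast card_localCocycles_mul_le b P Q

/-- Holley's condition: the small-cube weights live on sets without outer plaquettes, a property
inherited by `a ∩ a'`, and the cocycle counts are log-supermodular. The wired case is dual, with `a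
∪ a'`. -/
lemma prob_free_mono [NeZero q] {n N : ℕ} (h : n ≤ N) {p : ℝ} (h0 : 0 ≤ p) (h1 : p < 1)
    {A : Set (Config d (k + 1))} (hA : LocalEvent n A) (hup : IsUpperSet A) :
    prob q n .free p A ≤ prob q N .free p A := by
  classical
  obtain ⟨hpos, hprob⟩ := prob_eq_embWeight (q := q) h .free h0 h1 hA
  rw [hprob, prob_eq_sum]
  refine holley_ratio (embWeight_nonneg q n N _ h0 h1.le) (weight_nonneg q N _ h0 h1.le)
    (fun a => by dsimp; split_ifs <;> simp) ?_ hpos (sum_weight_pos N _ h0 h1) ?_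
  · intro a a' haa
    by_cases ha : toConfig N a ∈ A
    · simp [ha, hup (toConfig_mono haa) ha]
    · simp only [ha, if_false]; split_ifs <;> simp
  · intro a a'
    by_cases ha : ∀ τ : IntCell d (k + 1) N, ¬ Inner n τ.1.1 τ.1.2.1 → (τ ∈ a ↔ BC.free = .wired)
    · have ha' : ∀ τ : IntCell d (k + 1) N, ¬ Inner n τ.1.1 τ.1.2.1 →
          (τ ∈ a ∩ a' ↔ BC.free = .wired) := by
        intro τ hτ
        have := ha τ hτ
        simp only [reduceCtorEq, iff_false] at this ⊢
        exact fun h => this (Finset.mem_of_mem_inter_left h)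
      rw [embWeight, embWeight, if_pos ha, if_pos ha']
      -- The cardinality bounds ensure that no subtraction in the exponents is truncated, so the
      -- powers of `p` and `1 - p` agree on both sides.
      have hc : a.card ≤ Fintype.card (IntCell d (k + 1) n) := by
        obtain ⟨P, rfl⟩ := mem_range_enlarge h .free ha
        rw [card_enlarge]
        simpa [outer] using Finset.card_le_univ P
      have hc1 := Finset.card_inter_add_card_union a a'
      have hc2 := Finset.card_le_univ (a ∪ a')
      have hc3 := Finset.card_le_card (Finset.inter_subset_left (s₁ := a) (s₂ := a'))
      have hc4 := Finset.card_le_card (Finset.subset_union_right (s₁ := a) (s₂ := a'))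
      have hc5 : (outer (d := d) (k := k + 1) n N .free).card = 0 := rfl
      exact mul_pow_le h0 (by linarith) (by omega) (by omega) (card_cast_mul_le .free a a')
    · rw [embWeight, if_neg ha, zero_mul]
      exact mul_nonneg (embWeight_nonneg q n N _ h0 h1.le _) (weight_nonneg q N _ h0 h1.le _)

lemma prob_wired_anti [NeZero q] {n N : ℕ} (h : n ≤ N) {p : ℝ} (h0 : 0 ≤ p) (h1 : p < 1)
    {A : Set (Config d (k + 1))} (hA : LocalEvent n A) (hup : IsUpperSet A) :
    prob q N .wired p A ≤ prob q n .wired p A := by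
  classical
  obtain ⟨hpos, hprob⟩ := prob_eq_embWeight (q := q) h .wired h0 h1 hA
  rw [hprob, prob_eq_sum]
  refine holley_ratio (weight_nonneg q N _ h0 h1.le) (embWeight_nonneg q n N _ h0 h1.le)
    (fun a => by dsimp; split_ifs <;> simp) ?_ (sum_weight_pos N _ h0 h1) hpos ?_
  · intro a a' haa
    by_cases ha : toConfig N a ∈ A
    · simp [ha, hup (toConfig_mono haa) ha]
    · simp only [ha, if_false]; split_ifs <;> simp
  · intro a a'
    by_cases ha : ∀ τ : IntCell d (k + 1) N, ¬ Inner n τ.1.1 τ.1.2.1 → (τ ∈ a' ↔ BC.wired = .wired)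
    · have ha' : ∀ τ : IntCell d (k + 1) N, ¬ Inner n τ.1.1 τ.1.2.1 →
          (τ ∈ a ∪ a' ↔ BC.wired = .wired) := fun τ hτ =>
        ⟨fun _ => rfl, fun _ => Finset.mem_union_right _ ((ha τ hτ).2 rfl)⟩
      rw [embWeight, embWeight, if_pos ha, if_pos ha']
      have hcard : ∀ c : Finset (IntCell d (k + 1) N), (∀ τ : IntCell d (k + 1) N,
          ¬ Inner n τ.1.1 τ.1.2.1 → (τ ∈ c ↔ BC.wired = .wired)) →
          (outer (d := d) (k := k + 1) n N .wired).card ≤ c.card ∧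
          c.card ≤ Fintype.card (IntCell d (k + 1) n) +
            (outer (d := d) (k := k + 1) n N .wired).card := by
        intro c hc
        obtain ⟨P, rfl⟩ := mem_range_enlarge h .wired hc
        rw [card_enlarge]
        have := Finset.card_le_univ P
        omega
      have hc := hcard _ ha
      have hc' := hcard _ ha'
      have hc1 := Finset.card_inter_add_card_union a a'
      have hc2 := Finset.card_le_univ a
      have hc3 := Finset.card_le_card (Finset.inter_subset_left (s₁ := a) (s₂ := a'))
      have hc4 := Finset.card_le_card (Finset.subset_union_right (s₁ := a) (s₂ := a'))
      exact mul_pow_le h0 (by linarith) (by omega) (by omega) (card_cast_mul_le .wired a a')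
    · rw [embWeight, if_neg ha, mul_zero]
      exact mul_nonneg (weight_nonneg q N _ h0 h1.le _) (embWeight_nonneg q n N _ h0 h1.le _)

lemma prob_mono [NeZero q] {N : ℕ} (b : BC) {p : ℝ} (h0 : 0 ≤ p) (h1 : p < 1)
    {A B : Set (Config d (k + 1))} (h : A ⊆ B) : prob q N b p A ≤ prob q N b p B := by
  unfold prob
  refine div_le_div_of_nonneg_right (Finset.sum_le_sum fun P _ => ?_) (sum_weight_pos N b h0 h1).le
  have := weight_nonneg q N b h0 h1.le P
  by_cases hP : toConfig N P ∈ A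
  · simp [hP, h hP]
  · rw [if_neg hP]; split_ifs <;> simp [this]

lemma abs_prob_le_one [NeZero q] {N : ℕ} (b : BC) {p : ℝ} (h0 : 0 ≤ p) (h1 : p < 1)
    (A : Set (Config d (k + 1))) : |prob q N b p A| ≤ 1 := by
  have hpos := sum_weight_pos (d := d) (k := k) (q := q) N b h0 h1
  have hu : prob q N b p (Set.univ : Set (Config d (k + 1))) = 1 := by
    simp [prob, div_self hpos.ne']
  have he : prob q N b p (∅ : Set (Config d (k + 1))) = 0 := by simp [prob]
  rw [abs_of_nonneg (he.symm.le.trans (prob_mono b h0 h1 (Set.empty_subset A))), ← hu]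
  exact prob_mono b h0 h1 (Set.subset_univ A)

lemma exists_tendsto_of_mono {a : ℕ → ℝ} {n₀ : ℕ} (ha : ∀ n, n₀ ≤ n → ∀ N, n ≤ N → a n ≤ a N)
    (hb : ∀ n, |a n| ≤ 1) : ∃ ℓ, Tendsto a atTop (𝓝 ℓ) := by
  have hm : Monotone fun n => a (n + n₀) := fun m n h =>
    ha _ (Nat.le_add_left _ _) _ (Nat.add_le_add_right h _)
  refine ⟨_, (tendsto_add_atTop_iff_nat n₀).1 (tendsto_atTop_ciSup hm ⟨1, ?_⟩)⟩
  rintro _ ⟨n, rfl⟩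
  exact (abs_le.1 (hb _)).2

lemma exists_tendsto_of_anti {a : ℕ → ℝ} {n₀ : ℕ} (ha : ∀ n, n₀ ≤ n → ∀ N, n ≤ N → a N ≤ a n)
    (hb : ∀ n, |a n| ≤ 1) : ∃ ℓ, Tendsto a atTop (𝓝 ℓ) := by
  obtain ⟨ℓ, h⟩ := exists_tendsto_of_mono (a := fun n => -a n) (n₀ := n₀)
    (fun n hn N hN => neg_le_neg (ha n hn N hN)) (by simpa using hb)
  exact ⟨-ℓ, by simpa using h.neg⟩

lemma exists_tendsto_prob [NeZero q] (b : BC) {p : ℝ} (h0 : 0 ≤ p) (h1 : p < 1) {n₀ : ℕ}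
    {A : Set (Config d (k + 1))} (hA : LocalEvent n₀ A) (hup : IsUpperSet A) :
    ∃ ℓ, Tendsto (fun N => prob q N b p A) atTop (𝓝 ℓ) := by
  cases b with
  | free =>
    exact exists_tendsto_of_mono
      (fun n hn N hN => prob_free_mono hN h0 h1 (hA.mono hn) hup) fun n => abs_prob_le_one _ h0 h1 A
  | wired =>
    exact exists_tendsto_of_anti
      (fun n hn N hN => prob_wired_anti hN h0 h1 (hA.mono hn) hup) fun n => abs_prob_le_one _ h0 h1 A

lemma localEvent_localV (b : BC) (n : ℕ) (γ : Chain d k q) : LocalEvent n (localV b n γ) :=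
  fun _ _ h => localV_congr b n γ h

/-- Both the measure and the event vary with `N`, but their monotonicities point the same way: up
for free, down for wired. -/
lemma exists_tendsto_prob_localV [NeZero q] (b : BC) {p : ℝ} (h0 : 0 ≤ p) (h1 : p < 1)
    (γ : Chain d k q) : ∃ ℓ, Tendsto (fun N => prob q N b p (localV b N γ)) atTop (𝓝 ℓ) := by
  obtain ⟨n₀, hn₀⟩ := exists_forall_inner γ.support
  have hb : ∀ n, |prob q n b p (localV b n γ)| ≤ 1 := fun n => abs_prob_le_one b h0 h1 _
  cases b with
  | free =>
    exact exists_tendsto_of_mono (n₀ := 0) (fun n _ N hN =>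
      (prob_free_mono hN h0 h1 (localEvent_localV _ n γ) (isUpperSet_localV _ n γ)).trans
        (prob_mono _ h0 h1 (localV_free_mono hN γ))) hb
  | wired =>
    exact exists_tendsto_of_anti (n₀ := n₀) (fun n hn N hN =>
      (prob_mono _ h0 h1 (localV_wired_anti hN fun σ hσ => (σ.inner_iff.1 (hn₀ n hn σ hσ)).1)).trans
        (prob_wired_anti hN h0 h1 (localEvent_localV _ n γ) (isUpperSet_localV _ n γ))) hb

/-! ### Infinite volume limits -/

lemma LocalEvent.isClopen {n : ℕ} {A : Set (Config d k)} (hA : LocalEvent n A) : IsClopen A := by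
  let r : Config d k → (IntCell d k n → Bool) := fun ω τ => ω τ.1
  have hr : Continuous r := continuous_pi fun τ => continuous_apply τ.1
  have : A = r ⁻¹' (r '' A) := by
    refine Set.Subset.antisymm (Set.subset_preimage_image r A) ?_
    rintro ω ⟨ω', hω', e⟩
    exact (hA ω' ω fun σ hσ => congrFun e ⟨σ, σ.inner_iff.1 hσ⟩).1 hω'
  rw [this]
  exact (isClopen_discrete _).preimage hr

lemma tendsto_real_of_isClopen {X : Type*} [TopologicalSpace X] [MeasurableSpace X]
    [OpensMeasurableSpace X] [HasOuterApproxClosed X] {u : ℕ → ProbabilityMeasure X}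
    {μ : ProbabilityMeasure X} (h : Tendsto u atTop (𝓝 μ)) {A : Set X} (hA : IsClopen A) :
    Tendsto (fun N => (u N : Measure X).real A) atTop (𝓝 ((μ : Measure X).real A)) := by
  have h' := ProbabilityMeasure.tendsto_measure_of_null_frontier_of_tendsto' h
    (E := A) (by rw [hA.frontier_eq]; simp)
  exact (ENNReal.tendsto_toReal (measure_ne_top _ _)).comp h'

lemma exists_tendsto_prcm [NeZero q] (b : BC) (p : unitInterval) (h1 : (p : ℝ) < 1) :
    ∃ μ : ProbabilityMeasure (Config d (k + 1)), Tendsto (prcm d k q b p) atTop (𝓝 μ) := by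
  classical
  -- These events are increasing and local, so their probabilities converge; their indicators are
  -- closed under products and separate configurations.
  let A (J : Finset (Cell d (k + 1))) : Set (Config d (k + 1)) := {ω | ∀ σ ∈ J, ω σ = true}
  have hloc : ∀ J, ∃ n, LocalEvent n (A J) := by
    intro J
    obtain ⟨n, hn⟩ := exists_forall_inner J
    exact ⟨n, fun ω ω' h => forall₂_congr fun σ hσ => by rw [h σ (hn n le_rfl σ hσ)]⟩
  have hup : ∀ J, IsUpperSet (A J) := fun J ω ω' h hω σ hσ =>
    top_le_iff.1 ((hω σ hσ).symm.le.trans (h σ))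
  have hclopen : ∀ J, IsClopen (A J) := fun J => (hloc J).elim fun _ h => h.isClopen
  have hind : ∀ J : Finset (Cell d (k + 1)),
      Continuous ((A J).indicator (1 : Config d (k + 1) → ℂ)) := fun J =>
    continuous_one.indicator (by simp [(hclopen J).frontier_eq])
  let S : Submonoid C(Config d (k + 1), ℂ) :=
    { carrier := {f | ∃ J, ⇑f = (A J).indicator 1}
      one_mem' := ⟨∅, by ext ω; simp [A]⟩
      mul_mem' := by
        rintro f g ⟨J, hJ⟩ ⟨K, hK⟩
        refine ⟨J ∪ K, ?_⟩
        have : A (J ∪ K) = A J ∩ A K := by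
          ext ω
          simp only [A, Set.mem_inter_iff, Set.mem_ofPred_eq, Finset.mem_union]
          exact ⟨fun h => ⟨fun σ hσ => h σ (Or.inl hσ), fun σ hσ => h σ (Or.inr hσ)⟩,
            fun h σ hσ => hσ.elim (h.1 σ) (h.2 σ)⟩
        rw [ContinuousMap.coe_mul, hJ, hK, this, Set.inter_indicator_one] }
  refine exists_tendsto_of_separating _ S ?_ ?_ ?_
  · rintro f ⟨J, hJ⟩
    refine ⟨J, ?_⟩
    ext ω
    rw [ContinuousMap.star_apply, hJ]
    by_cases h : ω ∈ A J <;> simp [h]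
  · intro ω ω' h
    obtain ⟨σ, hσ⟩ := Function.ne_iff.1 h
    refine ⟨⟨_, hind {σ}⟩, ⟨{σ}, rfl⟩, ?_⟩
    have e : ∀ ω : Config d (k + 1), ω ∈ A {σ} ↔ ω σ = true := fun ω =>
      ⟨fun h => h σ (Finset.mem_singleton_self σ), fun h τ hτ => by
        rw [Finset.mem_singleton.1 hτ, h]⟩
    simp only [ContinuousMap.coe_mk, Set.indicator_apply, e]
    cases h1 : ω σ <;> cases h2 : ω' σ <;> simp_all
  · rintro f ⟨J, hJ⟩
    obtain ⟨n, hn⟩ := hloc J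
    obtain ⟨ℓ, hℓ⟩ := exists_tendsto_prob (q := q) b p.2.1 h1 hn (hup J)
    refine ⟨ℓ, ((Complex.continuous_ofReal.tendsto ℓ).comp hℓ).congr fun N => ?_⟩
    rw [hJ, Function.comp_apply, ← prcm_real_eq_prob N b p (hclopen J).1.measurableSet]
    have := integral_indicator_const (μ := (prcm d k q b p N : Measure (Config d (k + 1))))
      (1 : ℂ) (hclopen J).1.measurableSet
    rw [show (1 : Config d (k + 1) → ℂ) = fun _ => 1 from rfl, this]
    simp

lemma wilson_add [NeZero q] (γ η : Chain d k q) (f : Cochain d k q) :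
    wilson (γ + η) f = wilson γ f * wilson η f := by
  rw [wilson, evalChain_add, AddChar.map_add_eq_mul]; rfl

/-- The variables `wilson γ`, for all chains `γ`, are closed under products and conjugation, and
those of single cells already separate cochains. Their means converge by the finite-volume identity.
-/
lemma exists_tendsto_plgt [NeZero q] (b : BC) {β p : ℝ} (hp : p = 1 - Real.exp (-β)) (h0 : 0 ≤ p) :
    ∃ ν : ProbabilityMeasure (Cochain d k q), Tendsto (plgt d k q b β) atTop (𝓝 ν) := by
  have h1 : p < 1 := by rw [hp]; linarith [Real.exp_pos (-β)]
  let S : Submonoid C(Cochain d k q, ℂ) :=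
    { carrier := {f | ∃ γ : Chain d k q, ⇑f = wilson γ}
      one_mem' := ⟨0, by ext f; simp [wilson, evalChain]⟩
      mul_mem' := by
        rintro f g ⟨γ, hγ⟩ ⟨η, hη⟩
        refine ⟨γ + η, ?_⟩
        ext x
        rw [ContinuousMap.mul_apply, hγ, hη, wilson_add] }
  refine exists_tendsto_of_separating _ S ?_ ?_ ?_
  · rintro f ⟨γ, hγ⟩
    refine ⟨-γ, ?_⟩
    ext x
    have : evalChain x (-γ) = -evalChain x γ := by simp [evalChain_eq_linearCombination]
    rw [ContinuousMap.star_apply, hγ, wilson, wilson, this, AddChar.map_neg_eq_conj]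
    rfl
  · intro f g h
    obtain ⟨σ, hσ⟩ := Function.ne_iff.1 h
    refine ⟨⟨_, continuous_wilson (Finsupp.single σ 1)⟩, ⟨_, rfl⟩, fun e => hσ ?_⟩
    have := ZMod.injective_stdAddChar e
    simpa [evalChain] using this
  · rintro f ⟨γ, hγ⟩
    obtain ⟨ℓ, hℓ⟩ := exists_tendsto_prob_localV b h0 h1 γ
    obtain ⟨n₀, hn₀⟩ := exists_forall_inner γ.support
    refine ⟨ℓ, ((Complex.continuous_ofReal.tendsto ℓ).comp hℓ).congr' ?_⟩
    filter_upwards [eventually_ge_atTop n₀] with N hN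
    rw [hγ, integral_wilson_eq_prob b hp fun σ hσ => (σ.inner_iff.1 (hn₀ N hN σ hσ)).1]
    rfl

/-- The finite volume probabilities of the local events converge to the probability of `V_γ`. -/
lemma tendsto_prob_localV [NeZero q] (hk : k + 1 < d) (b : BC) {p : unitInterval}
    (h1 : (p : ℝ) < 1) {μ : ProbabilityMeasure (Config d (k + 1))}
    (hμ : Tendsto (prcm d k q b p) atTop (𝓝 μ)) (γ : Chain d k q) :
    Tendsto (fun N => prob q N b p (localV b N γ)) atTop
      (𝓝 ((μ : Measure (Config d (k + 1))).real (V γ b))) := by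
  have h0 : (0 : ℝ) ≤ p := p.2.1
  obtain ⟨ℓ, hℓ⟩ := exists_tendsto_prob_localV b h0 h1 γ
  obtain ⟨n₀, hn₀⟩ := exists_forall_inner γ.support
  have hbox : ∀ n ≥ n₀, ∀ σ ∈ γ.support, σ.InBox n := fun n hn σ hσ =>
    (σ.inner_iff.1 (hn₀ n hn σ hσ)).1
  have hclopen : ∀ n, IsClopen (localV b n γ) := fun n => (localEvent_localV b n γ).isClopen
  have hlim : ∀ n, Tendsto (fun N => prob q N b p (localV b n γ)) atTop
      (𝓝 ((μ : Measure (Config d (k + 1))).real (localV b n γ))) := fun n =>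
    (tendsto_real_of_isClopen hμ (hclopen n)).congr fun N =>
      prcm_real_eq_prob N b p (hclopen n).1.measurableSet
  have hV : Tendsto (fun n => (μ : Measure (Config d (k + 1))).real (localV b (n + n₀) γ)) atTop
      (𝓝 ((μ : Measure (Config d (k + 1))).real (V γ b))) := by
    refine (ENNReal.tendsto_toReal (measure_ne_top _ _)).comp ?_
    cases b with
    | free =>
      rw [V_free_eq_iUnion]
      exact (tendsto_add_atTop_iff_nat n₀).2 (tendsto_measure_iUnion_atTop
        fun m n h => localV_free_mono h γ)
    | wired =>
      rw [V_wired_eq_iInter hk γ (hbox n₀ le_rfl)]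
      exact tendsto_measure_iInter_atTop (fun n => (hclopen _).1.measurableSet.nullMeasurableSet)
        (fun m n h => localV_wired_anti (Nat.add_le_add_right h n₀) (hbox _ (Nat.le_add_left _ _)))
        ⟨0, measure_ne_top _ _⟩
  suffices h : Tendsto (fun n => (μ : Measure (Config d (k + 1))).real (localV b (n + n₀) γ)) atTop
      (𝓝 ℓ) by
    rwa [tendsto_nhds_unique hV h]
  -- Sandwich: the limiting probability of the `n`-th local event lies between its probability in
  -- the cube of size `n` and `ℓ`, and the former tends to `ℓ` as well.
  have hshift := (tendsto_add_atTop_iff_nat n₀).2 hℓ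
  cases b with
  | free =>
    refine tendsto_of_tendsto_of_tendsto_of_le_of_le hshift tendsto_const_nhds (fun n => ?_)
      (fun n => ?_)
    · refine ge_of_tendsto (hlim (n + n₀)) ?_
      filter_upwards [eventually_ge_atTop (n + n₀)] with N hN
      exact prob_free_mono hN h0 h1 (localEvent_localV _ _ γ) (isUpperSet_localV _ _ γ)
    · refine le_of_tendsto_of_tendsto (hlim (n + n₀)) hℓ ?_
      filter_upwards [eventually_ge_atTop (n + n₀)] with N hN
      exact prob_mono _ h0 h1 (localV_free_mono hN γ)
  | wired =>
    refine tendsto_of_tendsto_of_tendsto_of_le_of_le tendsto_const_nhds hshift (fun n => ?_)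
      (fun n => ?_)
    · refine le_of_tendsto_of_tendsto hℓ (hlim (n + n₀)) ?_
      filter_upwards [eventually_ge_atTop (n + n₀)] with N hN
      exact prob_mono _ h0 h1 (localV_wired_anti hN (hbox _ (Nat.le_add_left _ _)))
    · refine le_of_tendsto (hlim (n + n₀)) ?_
      filter_upwards [eventually_ge_atTop (n + n₀)] with N hN
      exact prob_wired_anti hN h0 h1 (localEvent_localV _ _ γ) (isUpperSet_localV _ _ γ)

end PlaquetteModel

end

theorem theorem2p2 (d k q : ℕ) [NeZero q] (hk : k + 1 < d - 1)
    (β : ℝ) (hβ : 0 ≤ β) (p : unitInterval) (hp : (p : ℝ) = 1 - Real.exp (-β))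
    (b : PlaquetteModel.BC) :
    ∃ (ν : ProbabilityMeasure (PlaquetteModel.Cochain d k q))
      (μ : ProbabilityMeasure (PlaquetteModel.Config d (k + 1))),
      Tendsto (fun N => PlaquetteModel.plgt d k q b β N) atTop (𝓝 ν) ∧
      Tendsto (fun N => PlaquetteModel.prcm d k q b p N) atTop (𝓝 μ) ∧
      ∀ γ : PlaquetteModel.Chain d k q, PlaquetteModel.IsCycle γ →
        ∫ f, PlaquetteModel.wilson γ f ∂(ν : Measure (PlaquetteModel.Cochain d k q)) =
          (((μ : Measure (PlaquetteModel.Config d (k + 1))).real (PlaquetteModel.V γ b) : ℝ) : ℂ) := by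
  have h1 : (p : ℝ) < 1 := by rw [hp]; linarith [Real.exp_pos (-β)]
  obtain ⟨ν, hν⟩ := PlaquetteModel.exists_tendsto_plgt (d := d) (k := k) (q := q) b hp p.2.1
  obtain ⟨μ, hμ⟩ := PlaquetteModel.exists_tendsto_prcm (d := d) (k := k) (q := q) b p h1
  refine ⟨ν, μ, hν, hμ, fun γ _ => ?_⟩
  have hW := PlaquetteModel.tendsto_integral_of_tendsto hν
    ⟨PlaquetteModel.wilson γ, PlaquetteModel.continuous_wilson γ⟩
  have hV := (Complex.continuous_ofReal.tendsto _).comp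
    (PlaquetteModel.tendsto_prob_localV (by omega) b h1 hμ γ)
  -- Both sides are limits of the same sequence, by the finite-volume identity in cubes that contain
  -- `γ`.
  refine tendsto_nhds_unique hW (hV.congr' ?_)
  obtain ⟨n₀, hn₀⟩ := PlaquetteModel.exists_forall_inner γ.support
  filter_upwards [eventually_ge_atTop n₀] with N hN
  exact (PlaquetteModel.integral_wilson_eq_prob b hp
    fun σ hσ => (σ.inner_iff.1 (hn₀ N hN σ hσ)).1).symm
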